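/- **Conventions.** For a simplicial group $\mathbf X$ put $NX_n=\bigcap_{i=0}^{n-1}\ker(d_i\colon X_n\to X_{n-1})$ (so $NX_0=X_0$), let $D_n\le X_n$ be the subgroup generated by the degenerate elements, and let $$C_n(\mathbf X)=\frac{NX_n}{(NX_n\cap D_n)\,d_{n+1}(NX_{n+1}\cap D_{n+1})}.$$ A *construction data sequence* for a simplicial resolution of a group $G$ is a sequence $(Y_i,g^{(i)})_{i\ge 0}$ which determines the skeleta $\mathbf F^{(k)}$, each augmented over $G$, recursively as follows. * $Y_0$ is a set and $g^{(0)}\colon Y_0\to G$ is a function whose image generates $G$; $\mathbf F^{(0)}$ is the constant simplicial group on the free group $F(Y_0)$, with augmentation $F(Y_0)\to G$ induced by $g^{(0)}$. * For $k\ge 1$, $Y_k$ is a set and $g^{(k)}\colon Y_k\to F^{(k-1)}_{k-1}$ is a function. If $k=1$, its values lie in the kernel of $F(Y_0)\to G$ and generate this kernel as a normal subgroup. If $k\ge 2$, all faces of its values are trivial and the classes of its values generate $\pi_{k-1}(\mathbf F^{(k-1)})$ as a module over $F^{(k-1)}_{k-1}$ (acting by conjugation). The simplicial group $\mathbf F^{(k)}$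 is obtained from $\mathbf F^{(k-1)}$ by freely adjoining generators in dimension $k$: $F^{(k)}_n$ is the free product of $F^{(k-1)}_n$ and the free group on symbols $y_t$, for $y\in Y_k$ and $t\colon[n]\to[k]$ a monotone surjection, with $s_i(y_t)=y_{t\alpha_i}$ for the codegeneracies $\alpha_i$ and, for the cofaces $\delta_i$, $d_i(y_t)=y_{t\delta_i}$ if $t\delta_i$ is surjective, $d_i(y_t)=t'^*(g^{(k)}(y))$ if $t\delta_i=\delta_k t'$, and $d_i(y_t)=1$ if $t\delta_i=\delta_j t'$ with $j\ne k$. The augmentation to $G$ is the one extending that of $\mathbf F^{(k-1)}$. **Proposition.** Let $G$ be a group, and let $(Y_i,g^{(i)})_{i\ge0}$ be a construction data sequence for a simplicial resolution of $G$, with $k$-skeleta $\mathbf F^{(k)}$. Then for every $k\ge 2$ the group $C_k(\mathbf F^{(k)})$ is abelian, the conjugation action of $F^{(k)}_0$ on it, ${}^{x}\overline z=\overline{s_0^k(x)\,z\,s_0^k(x)^{-1}}$, factors through the augmentation $F^{(k)}_0\to G$ and makes it a $G$-module, and as such it is the free $G$-module (free $\mathbb Z[G]$-module) on $Y_k$,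 with basis the classes of the generators $y=y_{\mathrm{id}}$, $y\in Y_k$. -/

import Mathlib

universe u

namespace SimpGrp

open CategoryTheory Opposite Simplicial

/-! ### The Moore complex and the groups `C_n` -/

section Moore

variable (X : SimplicialObject GrpCat.{u})

/-- The `n`-th term of the Moore complex: the elements of `X_n` all of whose faces except possibly
the last one are trivial. -/
def moore (n : ℕ) : Subgroup (X _⦋n⦌) :=
  match n with
  | 0 => ⊤
  | n + 1 => ⨅ i : Fin (n + 1), (X.δ i.castSucc).hom.ker

/-- The subgroup `D_n` of `X_n` generated by the degenerate elements. -/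
def degen (n : ℕ) : Subgroup (X _⦋n⦌) :=
  match n with
  | 0 => ⊥
  | n + 1 => ⨆ i : Fin (n + 1), (X.σ i).hom.range

/-- The boundary `∂ = d_{n+1}` of the Moore complex, as a homomorphism on all of `X_{n+1}`. -/
def lastFace (n : ℕ) : X _⦋n + 1⦌ →* X _⦋n⦌ := (X.δ (Fin.last (n + 1))).hom

/-- The subgroup `(NX_n ∩ D_n) d_{n+1}(NX_{n+1} ∩ D_{n+1})` of `X_n`. -/
def peiffer (n : ℕ) : Subgroup (X _⦋n⦌) :=
  (moore X n ⊓ degen X n) ⊔ (moore X (n + 1) ⊓ degen X (n + 1)).map (lastFace X n)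

/-- The elements of `X_n` all of whose faces are trivial. -/
def cycles (n : ℕ) : Subgroup (X _⦋n⦌) :=
  match n with
  | 0 => ⊤
  | n + 1 => ⨅ i : Fin (n + 2), (X.δ i).hom.ker

/-- The subgroup `d_{n+1}(NX_{n+1})`. -/
def boundaries (n : ℕ) : Subgroup (X _⦋n⦌) := (moore X (n + 1)).map (lastFace X n)

/-- The iterated degeneracy `s_0^n : X_0 → X_n`, induced by the unique map `[n] → [0]`. -/
def totalDegen (n : ℕ) : X _⦋0⦌ →* X _⦋n⦌ :=
  (X.map (SimplexCategory.const ⦋n⦌ ⦋0⦌ 0).op).hom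

theorem mem_moore_succ {n : ℕ} {x : X _⦋n + 1⦌} :
    x ∈ moore X (n + 1) ↔ ∀ i : Fin (n + 1), (X.δ i.castSucc).hom x = 1 := by
  simp [moore, Subgroup.mem_iInf, MonoidHom.mem_ker]

instance moore_normal (n : ℕ) : (moore X n).Normal := by
  cases n with
  | zero => exact inferInstanceAs (⊤ : Subgroup _).Normal
  | succ n => exact Subgroup.normal_iInf_normal fun i => inferInstance

theorem σ_mem_degen {n : ℕ} (i : Fin (n + 1)) (x : X _⦋n⦌) :
    (X.σ i).hom x ∈ degen X (n + 1) :=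
  Subgroup.mem_iSup_of_mem i (MonoidHom.mem_range.2 ⟨x, rfl⟩)

theorem lastFace_σ_last {n : ℕ} (x : X _⦋n⦌) :
    lastFace X n ((X.σ (Fin.last n)).hom x) = x := by
  have h := X.δ_comp_σ_succ (i := Fin.last n)
  exact congrArg (fun f => f.hom x) h

/-- The commutator `a b a⁻¹ b⁻¹`. -/
def comm {A : Type*} [Group A] (a b : A) : A := a * b * a⁻¹ * b⁻¹

theorem map_comm' {A B : Type*} [Group A] [Group B] (f : A →* B) (a b : A) :
    f (comm a b) = comm (f a) (f b) := by
  simp [comm]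

theorem comm_mem {A : Type*} [Group A] (H : Subgroup A) {a b : A} (ha : a ∈ H) (hb : b ∈ H) :
    comm a b ∈ H :=
  H.mul_mem (H.mul_mem (H.mul_mem ha hb) (H.inv_mem ha)) (H.inv_mem hb)

/-- The conjugate of `y` by `x` agrees with the conjugate of `y` by `s_{n-1} d_n x`, modulo
`d_{n+1}(NX_{n+1} ∩ D_{n+1})`. -/
theorem peiffer_comm {n : ℕ} {x y : X _⦋n + 1⦌} (hy : y ∈ moore X (n + 1)) :
    comm ((X.σ (Fin.last n)).hom (lastFace X n x)) y * comm y x ∈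
      (moore X (n + 2) ⊓ degen X (n + 2)).map (lastFace X (n + 1)) := by
  let sx := (X.σ (Fin.last n).castSucc).hom x
  let tx := (X.σ (Fin.last (n + 1))).hom x
  let ty := (X.σ (Fin.last (n + 1))).hom y
  refine Subgroup.mem_map.2 ⟨comm sx ty * comm ty tx, Subgroup.mem_inf.2 ⟨?_, ?_⟩, ?_⟩
  · refine (mem_moore_succ X).2 fun i => ?_
    refine Fin.lastCases ?_ (fun i => ?_) i
    · have h1 : (X.δ (Fin.last (n + 1)).castSucc).hom sx = x := by
        have h := X.δ_comp_σ_succ (i := (Fin.last n).castSucc)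
        exact congrArg (fun f => f.hom x) h
      have h2 : ∀ z, (X.δ (Fin.last (n + 1)).castSucc).hom
          ((X.σ (Fin.last (n + 1))).hom z) = z := fun z => by
        have h := X.δ_comp_σ_self (i := Fin.last (n + 1))
        exact congrArg (fun f => f.hom z) h
      rw [map_mul, map_comm', map_comm', h1, h2, h2]
      simp [comm, mul_assoc]
    · have h3 : (X.δ i.castSucc.castSucc).hom ty = 1 := by
        have h := X.δ_comp_σ_of_le (i := i.castSucc) (j := Fin.last n)
          (Fin.castSucc_le_castSucc_iff.2 (Fin.le_last _))
        have h' := congrArg (fun f => f.hom y) h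
        have hy' := (mem_moore_succ X).1 hy i
        refine Eq.trans h' ?_
        simp only [GrpCat.hom_comp, MonoidHom.comp_apply]
        exact (congrArg _ hy').trans (map_one _)
      rw [map_mul, map_comm', map_comm', h3]
      simp [comm]
  · have a := σ_mem_degen X (Fin.last n).castSucc x
    have b := σ_mem_degen X (Fin.last (n + 1)) x
    have c := σ_mem_degen X (Fin.last (n + 1)) y
    exact (degen X (n + 2)).mul_mem (comm_mem _ a c) (comm_mem _ c b)
  · have h1 : lastFace X (n + 1) sx = (X.σ (Fin.last n)).hom (lastFace X n x) := by
      have h := X.δ_comp_σ_of_gt (i := Fin.last (n + 1)) (j := Fin.last n) (by simp [Fin.lt_def])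
      exact congrArg (fun f => f.hom x) h
    rw [map_mul, map_comm', map_comm', h1, lastFace_σ_last, lastFace_σ_last]

theorem map_lastFace_normal (n : ℕ) :
    ((moore X (n + 1) ⊓ degen X (n + 1)).map (lastFace X n)).Normal := by
  refine ⟨fun v hv g => ?_⟩
  obtain ⟨w, hw, rfl⟩ := Subgroup.mem_map.1 hv
  obtain ⟨hw, hw'⟩ := Subgroup.mem_inf.1 hw
  have hg := σ_mem_degen X (Fin.last n) g
  refine Subgroup.mem_map.2
    ⟨(X.σ (Fin.last n)).hom g * w * ((X.σ (Fin.last n)).hom g)⁻¹,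
    Subgroup.mem_inf.2 ⟨(moore_normal X (n + 1)).conj_mem _ hw _,
      Subgroup.mul_mem _ (Subgroup.mul_mem _ hg hw') (Subgroup.inv_mem _ hg)⟩, ?_⟩
  rw [map_mul, map_mul, map_inv, lastFace_σ_last]

theorem conj_mem_peiffer (n : ℕ) (g y : X _⦋n⦌) (hg : g ∈ moore X n) (hy : y ∈ peiffer X n) :
    g * y * g⁻¹ ∈ peiffer X n := by
  have hB := map_lastFace_normal X n
  rw [peiffer] at hy
  obtain ⟨a, ha, b, hb, rfl⟩ := Subgroup.mem_sup_of_normal_right.1 hy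
  obtain ⟨ha1, ha2⟩ := Subgroup.mem_inf.1 ha
  have hb' : g * b * g⁻¹ ∈ peiffer X n :=
    Subgroup.mem_sup_right (hB.conj_mem _ hb g)
  have ha' : g * a * g⁻¹ ∈ peiffer X n := by
    cases n with
    | zero =>
      have h1 : a = 1 := Subgroup.mem_bot.1 ha2
      simp [h1, one_mem]
    | succ n =>
      have hd := σ_mem_degen X (Fin.last n) (lastFace X n g)
      have key := peiffer_comm X (x := g) ha1
      have e : g * a * g⁻¹ = (comm ((X.σ (Fin.last n)).hom (lastFace X n g)) a * comm a g)⁻¹ *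
          ((X.σ (Fin.last n)).hom (lastFace X n g) * a *
            ((X.σ (Fin.last n)).hom (lastFace X n g))⁻¹) := by
        simp only [comm]; group
      rw [e]
      exact Subgroup.mul_mem _ (Subgroup.mem_sup_right (Subgroup.inv_mem _ key))
        (Subgroup.mem_sup_left (Subgroup.mem_inf.2
          ⟨(moore_normal X (n + 1)).conj_mem _ ha1 _,
            Subgroup.mul_mem _ (Subgroup.mul_mem _ hd ha2) (Subgroup.inv_mem _ hd)⟩))
  have e : g * (a * b) * g⁻¹ = (g * a * g⁻¹) * (g * b * g⁻¹) := by group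
  rw [e]
  exact Subgroup.mul_mem _ ha' hb'

instance peiffer_normal (n : ℕ) : ((peiffer X n).subgroupOf (moore X n)).Normal :=
  ⟨fun y hy g => conj_mem_peiffer X n g y g.2 hy⟩

/-- The `n`-th group of the crossed complex associated to `X`,
`C_n(X) = NX_n / (NX_n ∩ D_n) d_{n+1}(NX_{n+1} ∩ D_{n+1})`. -/
abbrev C (n : ℕ) : Type u := moore X n ⧸ (peiffer X n).subgroupOf (moore X n)

theorem map_eq_one_of_mem_cycles {m : ℕ} {x : X _⦋m⦌} (hx : x ∈ cycles X m)
    {a : SimplexCategory} (φ : a ⟶ ⦋m⦌) (hφ : ¬ Function.Surjective φ) :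
    (X.map φ.op).hom x = 1 := by
  cases m with
  | zero => exact absurd (fun y => ⟨0, Subsingleton.elim (α := Fin 1) _ _⟩) hφ
  | succ m =>
    obtain ⟨i, θ, rfl⟩ := SimplexCategory.eq_comp_δ_of_not_surjective φ hφ
    have h : (X.δ i).hom x = 1 := MonoidHom.mem_ker.1 ((Subgroup.mem_iInf.1 hx) i)
    rw [op_comp, Functor.map_comp, GrpCat.hom_comp, MonoidHom.comp_apply]
    exact (congrArg _ h).trans (map_one _)

end Moore

/-! ### Attaching cells -/

section Kill

variable (X : SimplicialObject GrpCat.{u}) (m : ℕ) {Λ : Type u} (ϑ : Λ → X _⦋m⦌)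

/-- The indices `(λ, t)` of the new generators `y_{λ,t}` in dimension `a`: here `t` is a monotone
surjection `a → [m+1]`. -/
abbrev Cell (Λ : Type u) (a : SimplexCategory) : Type u :=
  Λ × {t : a ⟶ ⦋m + 1⦌ // Function.Surjective t}

/-- The free `X_a`-group `X_a ∗ ⟨y_{λ,t}⟩`. -/
abbrev KillObj (Λ : Type u) (a : SimplexCategory) : Type u :=
  Monoid.Coprod (X.obj (op a)) (FreeGroup (Cell m Λ a))

open Classical in
/-- The value `y_{λ,u}` for an arbitrary monotone map `u : a → [m+1]`. It is a new generator if `u`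
is surjective. If `u = δ_{m+1} ∘ t'` misses the last vertex `m+1` then it is `t'^*(ϑ_λ)`, where
`t' : a → [m]` equals `α_m ∘ u` (`α_m` being the codegeneracy `SimplexCategory.σ (Fin.last m)`).
Otherwise `u` misses some other vertex, and the value is `1`. -/
noncomputable def cellVal (a : SimplexCategory) (u : a ⟶ ⦋m + 1⦌) (l : Λ) : KillObj X m Λ a :=
  if h : Function.Surjective u then Monoid.Coprod.inr (FreeGroup.of (l, ⟨u, h⟩))
  else if ∀ i, u i ≠ Fin.last (m + 1) then
    Monoid.Coprod.inl ((X.map (u ≫ SimplexCategory.σ (Fin.last m)).op).hom (ϑ l))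
  else 1

/-- The homomorphism induced by `ψ : b → a`: it is that of `X` on `X_a`, and sends `y_{λ,t}` to
`y_{λ,tψ}`. -/
noncomputable def killMap {a b : SimplexCategory} (ψ : b ⟶ a) :
    KillObj X m Λ a →* KillObj X m Λ b :=
  Monoid.Coprod.lift (Monoid.Coprod.inl.comp (X.map ψ.op).hom)
    (FreeGroup.lift fun c => cellVal X m ϑ b (ψ ≫ c.2.1) c.1)

theorem killMap_cellVal (hϑ : ∀ l, ϑ l ∈ cycles X m) {a b : SimplexCategory} (ψ : b ⟶ a)
    (u : a ⟶ ⦋m + 1⦌) (l : Λ) :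
    killMap X m ϑ ψ (cellVal X m ϑ a u l) = cellVal X m ϑ b (ψ ≫ u) l := by
  by_cases hu : Function.Surjective u
  · rw [cellVal, dif_pos hu, killMap, Monoid.Coprod.lift_apply_inr, FreeGroup.lift_apply_of]
  · have hs : ¬ Function.Surjective (ψ ≫ u) := fun h => hu fun y => by
      obtain ⟨z, hz⟩ := h y
      exact ⟨ψ z, by simpa using hz⟩
    by_cases hl : ∀ i, u i ≠ Fin.last (m + 1)
    · have hl' : ∀ i, (ψ ≫ u) i ≠ Fin.last (m + 1) := fun i => by simpa using hl (ψ i)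
      rw [cellVal, dif_neg hu, if_pos hl, cellVal, dif_neg hs, if_pos hl', killMap,
        Monoid.Coprod.lift_apply_inl]
      simp
    · rw [cellVal, dif_neg hu, if_neg hl, map_one, cellVal, dif_neg hs]
      split_ifs with h2
      · rw [map_eq_one_of_mem_cycles X (hϑ l), map_one]
        intro hsurj
        apply hu
        intro j
        by_cases hj : j = Fin.last (m + 1)
        · push Not at hl
          obtain ⟨i, hi⟩ := hl
          exact ⟨i, hi.trans hj.symm⟩
        · obtain ⟨j', rfl⟩ := Fin.exists_castSucc_eq.2 hj
          obtain ⟨z, hz⟩ := hsurj j'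
          refine ⟨ψ z, ?_⟩
          obtain ⟨w, hw⟩ := Fin.exists_castSucc_eq.2 (h2 z)
          have hw' : u (ψ z) = w.castSucc := by rw [hw]; simp
          have : (SimplexCategory.σ (Fin.last m)) (w.castSucc) = j' := by
            rw [hw]; simpa using hz
          have h3 : (SimplexCategory.σ (Fin.last m)) (w.castSucc) = w :=
            Fin.predAbove_castSucc_of_le _ _ (Fin.le_last _)
          rw [hw', ← this, h3]
      · rfl

/-- The simplicial group `X(Ω)` obtained from `X` by attaching free generators `y_λ` in dimension
`m + 1`, with `d_{m+1} y_λ = ϑ_λ` and all other faces trivial. -/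
noncomputable def kill (hϑ : ∀ l, ϑ l ∈ cycles X m) : SimplicialObject GrpCat.{u} where
  obj a := GrpCat.of (KillObj X m Λ a.unop)
  map ψ := GrpCat.ofHom (killMap X m ϑ ψ.unop)
  map_id a := by
    ext : 1
    refine Monoid.Coprod.hom_ext ?_ ?_
    · ext x; simp [killMap]
    · ext c
      simp only [killMap, GrpCat.hom_ofHom, MonoidHom.comp_apply, Monoid.Coprod.lift_apply_inr,
        FreeGroup.lift_apply_of]
      rw [cellVal, dif_pos (by simpa using c.2.2)]
      simp
  map_comp {a b c} φ ψ := by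
    ext : 1
    refine Monoid.Coprod.hom_ext ?_ ?_
    · ext x; simp [killMap]
    · ext d
      have h := killMap_cellVal X m ϑ hϑ ψ.unop (φ.unop ≫ d.2.1) d.1
      simp only [GrpCat.hom_ofHom, GrpCat.hom_comp, MonoidHom.comp_apply]
      have h1 : killMap X m ϑ φ.unop (Monoid.Coprod.inr (FreeGroup.of d)) =
          cellVal X m ϑ b.unop (φ.unop ≫ d.2.1) d.1 := by
        rw [killMap, Monoid.Coprod.lift_apply_inr, FreeGroup.lift_apply_of]
      rw [h1, h, killMap, Monoid.Coprod.lift_apply_inr, FreeGroup.lift_apply_of]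
      simp

/-- The new generator `y_λ` in dimension `m + 1`. -/
noncomputable def kill.gen (hϑ : ∀ l, ϑ l ∈ cycles X m) (l : Λ) :
    (kill X m ϑ hϑ) _⦋m + 1⦌ :=
  (Monoid.Coprod.inr (FreeGroup.of (l, ⟨𝟙 _, fun y => ⟨y, rfl⟩⟩)) : KillObj X m Λ ⦋m + 1⦌)

theorem kill.δ_gen (hϑ : ∀ l, ϑ l ∈ cycles X m) (l : Λ) (i : Fin (m + 2)) :
    ((kill X m ϑ hϑ).δ i).hom (kill.gen X m ϑ hϑ l) =
      cellVal X m ϑ ⦋m⦌ (SimplexCategory.δ i) l := by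
  change killMap X m ϑ (SimplexCategory.δ i) _ = _
  rw [killMap, kill.gen, Monoid.Coprod.lift_apply_inr, FreeGroup.lift_apply_of]
  simp

theorem δ_not_surjective {m : ℕ} (i : Fin (m + 2)) :
    ¬ Function.Surjective (SimplexCategory.δ i) := fun h => by
  obtain ⟨z, hz⟩ := h i
  exact Fin.succAbove_ne i z hz

theorem kill.δ_castSucc_gen (hϑ : ∀ l, ϑ l ∈ cycles X m) (l : Λ) (i : Fin (m + 1)) :
    ((kill X m ϑ hϑ).δ i.castSucc).hom (kill.gen X m ϑ hϑ l) = 1 := by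
  rw [kill.δ_gen, cellVal, dif_neg (δ_not_surjective _), if_neg]
  · rfl
  intro hne
  refine hne (Fin.last m) ?_
  exact (Fin.succAbove_of_le_castSucc _ _ (Fin.castSucc_le_castSucc_iff.2 (Fin.le_last _))).trans
    (Fin.succ_last m)

theorem kill.δ_last_gen (hϑ : ∀ l, ϑ l ∈ cycles X m) (l : Λ) :
    ((kill X m ϑ hϑ).δ (Fin.last (m + 1))).hom (kill.gen X m ϑ hϑ l) =
      (Monoid.Coprod.inl (ϑ l) : KillObj X m Λ ⦋m⦌) := by
  have h : SimplexCategory.δ (Fin.last (m + 1)) ≫ SimplexCategory.σ (Fin.last m) = 𝟙 _ :=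
    SimplexCategory.δ_comp_σ_succ (i := Fin.last m)
  rw [kill.δ_gen, cellVal, dif_neg (δ_not_surjective _), if_pos, h]
  · exact congrArg _ (DFunLike.congr_fun (congrArg GrpCat.Hom.hom (X.map_id (op ⦋m⦌))) (ϑ l))
  · intro i
    exact Fin.succAbove_ne _ i

end Kill

/-! ### Construction data for a resolution of a group -/

variable (G : Type u) [Group G]

/-- A simplicial group augmented over `G` by a surjection. -/
structure Augmented where
  obj : SimplicialObject GrpCat.{u}
  aug : obj _⦋0⦌ →* G
  aug_face : ∀ x : obj _⦋1⦌, aug ((obj.δ 0).hom x) = aug ((obj.δ 1).hom x)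
  aug_surjective : Function.Surjective aug

variable {G}

/-- The elements of dimension `m` all of whose faces are trivial, where the augmentation counts as
the face of an element of dimension `0`. -/
def Augmented.cycles (S : Augmented G) (m : ℕ) : Subgroup (S.obj _⦋m⦌) :=
  match m with
  | 0 => S.aug.ker
  | m + 1 => SimpGrp.cycles S.obj (m + 1)

theorem Augmented.mem_cycles (S : Augmented G) {m : ℕ} {x : S.obj _⦋m⦌} (hx : x ∈ S.cycles m) :
    x ∈ SimpGrp.cycles S.obj m := by
  cases m with
  | zero => exact Subgroup.mem_top x
  | succ m => exact hx

/-- `m`-dimensional construction data for an augmented simplicial group: a set `Ω` and a function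
from `Ω` to the elements of dimension `m` with trivial faces, whose classes generate the `m`-th
homotopy group `π_m = cycles / boundaries` as a module over `S_m` acting by conjugation. For `m = 0`
and constant `S` this says that the image normally generates the kernel of the augmentation. -/
structure AttachingData (S : Augmented G) (m : ℕ) where
  Ω : Type u
  g : Ω → S.obj _⦋m⦌
  mem_cycles : ∀ l, g l ∈ S.cycles m
  generates : S.cycles m ≤ Subgroup.normalClosure (Set.range g) ⊔ boundaries S.obj m

/-- The augmentation in dimension zero after attaching cells of dimension `m + 1`. -/
noncomputable def killAug (S : Augmented G) (m : ℕ) (A : AttachingData S m) :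
    KillObj S.obj m A.Ω ⦋0⦌ →* G :=
  Monoid.Coprod.lift S.aug 1

theorem killAug_cellVal (S : Augmented G) (m : ℕ) (A : AttachingData S m) (u : ⦋0⦌ ⟶ ⦋m + 1⦌)
    (l : A.Ω) : killAug S m A (cellVal S.obj m A.g ⦋0⦌ u l) = 1 := by
  rw [cellVal, killAug]
  split_ifs with h1 h2
  · rw [Monoid.Coprod.lift_apply_inr, MonoidHom.one_apply]
  · rw [Monoid.Coprod.lift_apply_inl]
    cases m with
    | zero =>
      have : u ≫ SimplexCategory.σ (Fin.last 0) = 𝟙 _ := SimplexCategory.hom_zero_zero _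
      rw [this]
      simpa using MonoidHom.mem_ker.1 (A.mem_cycles l)
    | succ m =>
      rw [map_eq_one_of_mem_cycles S.obj (S.mem_cycles (A.mem_cycles l)), map_one]
      intro h
      have h0 : ∀ y : Fin (m + 2), y = (u ≫ SimplexCategory.σ (Fin.last (m + 1))) 0 := fun y => by
        obtain ⟨z, rfl⟩ := h y
        rw [Subsingleton.elim (α := Fin 1) z 0]
      have := (h0 0).trans (h0 1).symm
      simp at this
  · exact map_one _

/-- The augmented simplicial group obtained by attaching cells of dimension `m + 1`. -/
noncomputable def AttachingData.attach {S : Augmented G} {m : ℕ} (A : AttachingData S m) :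
    Augmented G where
  obj := kill S.obj m A.g fun l => S.mem_cycles (A.mem_cycles l)
  aug := killAug S m A
  aug_face x := by
    have : (killAug S m A).comp (killMap S.obj m A.g (SimplexCategory.δ (0 : Fin 2))) =
        (killAug S m A).comp (killMap S.obj m A.g (SimplexCategory.δ (1 : Fin 2))) := by
      refine Monoid.Coprod.hom_ext ?_ ?_
      · ext x
        simpa [killMap, killAug, SimplicialObject.δ_def] using S.aug_face x
      · ext c
        simp only [MonoidHom.comp_apply]
        rw [killMap, killMap, Monoid.Coprod.lift_apply_inr, Monoid.Coprod.lift_apply_inr,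
          FreeGroup.lift_apply_of, FreeGroup.lift_apply_of, killAug_cellVal, killAug_cellVal]
    exact DFunLike.congr_fun this x
  aug_surjective y := by
    obtain ⟨x, rfl⟩ := S.aug_surjective y
    exact ⟨(Monoid.Coprod.inl x : KillObj S.obj m A.Ω ⦋0⦌), Monoid.Coprod.lift_apply_inl ..⟩

variable (G)

/-- A generating family `Y → G`, in the form of a surjection from the free group on `Y`. -/
structure GeneratingData where
  Y : Type u
  g : Y → G
  surjective : Function.Surjective (FreeGroup.lift g)

variable {G}

/-- The constant simplicial group on the free group on the generators. -/
noncomputable def GeneratingData.stage (P : GeneratingData G) : Augmented G where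
  obj := (SimplicialObject.const GrpCat.{u}).obj (GrpCat.of (FreeGroup P.Y))
  aug := FreeGroup.lift P.g
  aug_face _ := rfl
  aug_surjective := P.surjective

variable (G)

/-- A `k`-th level presentation of `G` consists of generating data, together with
`m`-dimensional construction data for the `m`-skeleton for each `m < k`; it is defined by recursion
along with the `k`-skeleton that it determines. -/
noncomputable def levelAux (n : ℕ) : Σ P : Type (u + 1), P → Augmented G :=
  match n with
  | 0 => ⟨GeneratingData G, GeneratingData.stage⟩
  | k + 1 => ⟨Σ p : (levelAux k).1, AttachingData ((levelAux k).2 p) k, fun q => q.2.attach⟩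

/-- The `k`-th level presentations of `G`. -/
def LevelPresentation (k : ℕ) : Type (u + 1) := (levelAux G k).1

variable {G}

/-- The augmented simplicial group `F^(k)` determined by a `k`-th level presentation. -/
noncomputable def LevelPresentation.skeleton {k : ℕ} (p : LevelPresentation G k) : Augmented G :=
  (levelAux G k).2 p

/-- The `k`-th level presentation underlying a `(k+1)`-st level presentation. -/
def LevelPresentation.restrict {k : ℕ} (p : LevelPresentation G (k + 1)) : LevelPresentation G k :=
  Sigma.fst (β := fun q => AttachingData ((levelAux G k).2 q) k) p

/-- The `k`-dimensional construction data in a `(k+1)`-st level presentation. -/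
def LevelPresentation.data {k : ℕ} (p : LevelPresentation G (k + 1)) :
    AttachingData p.restrict.skeleton k :=
  Sigma.snd (β := fun q => AttachingData ((levelAux G k).2 q) k) p

theorem LevelPresentation.skeleton_succ {k : ℕ} (p : LevelPresentation G (k + 1)) :
    p.skeleton = p.data.attach := rfl

/-- The set `Y_k` of non-degenerate generators of dimension `k`. -/
def LevelPresentation.Y {k : ℕ} (p : LevelPresentation G k) : Type u :=
  match k, p with
  | 0, p => GeneratingData.Y (G := G) p
  | _ + 1, p => p.data.Ω

/-- The elements of `F^(k)_k` given by the generators in `Y_k`. -/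
noncomputable def LevelPresentation.gen {k : ℕ} (p : LevelPresentation G k) :
    p.Y → p.skeleton.obj _⦋k⦌ :=
  match k, p with
  | 0, p => fun y => (FreeGroup.of y : FreeGroup (GeneratingData.Y (G := G) p))
  | k + 1, p => fun y => kill.gen p.restrict.skeleton.obj k p.data.g
      (fun l => p.restrict.skeleton.mem_cycles (p.data.mem_cycles l)) y

theorem LevelPresentation.gen_mem {k : ℕ} (p : LevelPresentation G k) (y : p.Y) :
    p.gen y ∈ moore p.skeleton.obj k :=
  match k, p, y with
  | 0, _, _ => Subgroup.mem_top _
  | k + 1, p, y => (mem_moore_succ _).2 (kill.δ_castSucc_gen p.restrict.skeleton.obj k p.data.g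
      (fun l => p.restrict.skeleton.mem_cycles (p.data.mem_cycles l)) y)

variable (G)

/-- A construction data sequence for a simplicial resolution of `G`: a compatible sequence of level
presentations. -/
structure ConstructionData where
  level : ∀ k : ℕ, LevelPresentation G k
  restrict_level : ∀ k, (level (k + 1)).restrict = level k

variable {G}

/-- The `k`-skeleton `F^(k)` of the resolution, augmented over `G`. -/
noncomputable def ConstructionData.skeleton (F : ConstructionData G) (k : ℕ) : Augmented G :=
  (F.level k).skeleton

/-- The set `Y_k` of the construction data sequence. -/
def ConstructionData.Y (F : ConstructionData G) (k : ℕ) : Type u := (F.level k).Y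

/-- The elements of the Moore complex of the `k`-skeleton given by `Y_k`. -/
noncomputable def ConstructionData.gen (F : ConstructionData G) (k : ℕ) (y : F.Y k) :
    moore (F.skeleton k).obj k :=
  ⟨(F.level k).gen y, (F.level k).gen_mem y⟩

/-- The class in `C_n(X)` of an element of the Moore complex. -/
def C.mk (X : SimplicialObject GrpCat.{u}) (n : ℕ) : moore X n →* C X n :=
  QuotientGroup.mk' _

/-- The conjugation action `z ↦ s_0^n(x) z s_0^n(x)⁻¹` of `X_0` on the Moore complex. -/
def conjDegen (X : SimplicialObject GrpCat.{u}) (n : ℕ) (x : X _⦋0⦌) (z : moore X n) :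
    moore X n :=
  ⟨totalDegen X n x * z * (totalDegen X n x)⁻¹, (moore_normal X n).conj_mem _ z.2 _⟩

/-- The commutative group with the given operations. -/
abbrev commGroupOf {A : Type u} [Group A] (h : ∀ a b : A, a * b = b * a) : CommGroup A :=
  { (inferInstance : Group A) with mul_comm := h }

end SimpGrp

namespace SimpGrp

open CategoryTheory Opposite Simplicial

/-! ### Elementwise simplicial identities -/

section Identities

variable (X : SimplicialObject GrpCat.{u})

/-! Let `X` be the k-skeleton, k ≥ 2. It arises by attaching the k-cells in `Y_k` to a skeleton
whose elements of dimension k are all products of degenerate ones. The proof shows that the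
translates of the cells generate `C_k`, and then that they are independent over `ℤ[G]`.

Generation: `actTrivial` consists of the elements of `X_k` that centralise the Moore complex modulo
`peiffer`. By the Peiffer commutator, every `g` acts as the degenerate element `s_{k-1} d_k g`, and
a degenerate element acts as the total degeneracy of its last vertex
(`mul_inv_totalDegen_mem_actTrivial`). For k ≥ 2 it follows that `NX_k` acts trivially
(`moore_le_actTrivial`), so `C_k` is abelian. The elements of `d_1(ker d_0)` in `X_0` also act
trivially (`totalDegen_mem_actTrivial`). They exhaust the kernel of the augmentation
(`skeleton_isExact`), so the action factors through `G`. As old elements are degenerate, the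
translates of the new generators generate `C_k` (`closure_conjDegen_eq_top`).

Independence: the Fox derivative `fox` is a crossed homomorphism from `X_k` to `ℤ[G]^{Y_k}` that
kills old elements and sends a cell to its basis vector. The alternating sum of the derivatives of
the faces vanishes on `X_{k+1}` (`foxSum_eq_zero`), so `fox` vanishes on `peiffer` and induces
`foxC` on `C_k`. This map has an inverse (`bijective_foxC`), and the module structure is transported
along it. -/

theorem δ_σ_of_le {n i j : ℕ} (hij : i ≤ j) (hj : j < n + 1) (x : X _⦋n + 1⦌) :
    (X.δ ⟨i, by omega⟩).hom ((X.σ ⟨j + 1, by omega⟩).hom x) =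
      (X.σ ⟨j, hj⟩).hom ((X.δ ⟨i, by omega⟩).hom x) :=
  congrArg (fun f => f.hom x)
    (X.δ_comp_σ_of_le (n := n) (i := ⟨i, by omega⟩) (j := ⟨j, hj⟩) (by simpa [Fin.le_def]))

theorem δ_σ_of_gt {n i j : ℕ} (hij : j < i) (hi : i < n + 2) (x : X _⦋n + 1⦌) :
    (X.δ ⟨i + 1, by omega⟩).hom ((X.σ ⟨j, by omega⟩).hom x) =
      (X.σ ⟨j, by omega⟩).hom ((X.δ ⟨i, hi⟩).hom x) :=
  congrArg (fun f => f.hom x)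
    (X.δ_comp_σ_of_gt (n := n) (i := ⟨i, hi⟩) (j := ⟨j, by omega⟩) (by simpa [Fin.lt_def]))

theorem δ_σ_self {n j : ℕ} (hj : j < n + 1) (x : X _⦋n⦌) :
    (X.δ ⟨j, by omega⟩).hom ((X.σ ⟨j, hj⟩).hom x) = x :=
  congrArg (fun f => f.hom x) (X.δ_comp_σ_self (n := n) (i := ⟨j, hj⟩))

theorem δ_σ_succ {n j : ℕ} (hj : j < n + 1) (x : X _⦋n⦌) :
    (X.δ ⟨j + 1, by omega⟩).hom ((X.σ ⟨j, hj⟩).hom x) = x :=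
  congrArg (fun f => f.hom x) (X.δ_comp_σ_succ (n := n) (i := ⟨j, hj⟩))

theorem δ_δ_of_le {n i j : ℕ} (hij : i ≤ j) (hj : j < n + 2) (x : X _⦋n + 2⦌) :
    (X.δ ⟨i, by omega⟩).hom ((X.δ ⟨j + 1, by omega⟩).hom x) =
      (X.δ ⟨j, hj⟩).hom ((X.δ ⟨i, by omega⟩).hom x) :=
  congrArg (fun f => f.hom x)
    (X.δ_comp_δ (n := n) (i := ⟨i, by omega⟩) (j := ⟨j, hj⟩) (by simpa [Fin.le_def]))

theorem map_comp_apply {a b c : SimplexCategory} (f : a ⟶ b) (g : b ⟶ c) (x : X.obj (op c)) :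
    (X.map (f ≫ g).op).hom x = (X.map f.op).hom ((X.map g.op).hom x) := by
  simp

theorem mem_moore_succ' {n : ℕ} {x : X _⦋n + 1⦌} :
    x ∈ moore X (n + 1) ↔ ∀ i (hi : i < n + 1), (X.δ ⟨i, by omega⟩).hom x = 1 :=
  (mem_moore_succ X).trans ⟨fun h i hi => h ⟨i, hi⟩, fun h i => h i i.2⟩

theorem moore_δ_eq_one {n : ℕ} {x : X _⦋n + 1⦌} (hx : x ∈ moore X (n + 1)) {i : ℕ}
    (hi : i < n + 1) : (X.δ ⟨i, by omega⟩).hom x = 1 :=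
  (mem_moore_succ' X).1 hx i hi

end Identities

/-! ### The action on `C_n` -/

section Action

variable (X : SimplicialObject GrpCat.{u})

/-- Normality is needed in all of `X_n`, so that arbitrary elements act on the image of the Moore
complex in the quotient. Modulo boundaries of degenerate Moore elements, `g` conjugates `a` as a
degenerate element does, and the latter preserves both `NX` and `D`. -/
theorem peiffer_conj_mem (n : ℕ) (g : X _⦋n⦌) {y : X _⦋n⦌} (hy : y ∈ peiffer X n) :
    g * y * g⁻¹ ∈ peiffer X n := by
  have hB := map_lastFace_normal X n
  rw [peiffer] at hy
  obtain ⟨a, ha, b, hb, rfl⟩ := Subgroup.mem_sup_of_normal_right.1 hy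
  have hb' : g * b * g⁻¹ ∈ peiffer X n := Subgroup.mem_sup_right (hB.conj_mem _ hb g)
  suffices ha' : g * a * g⁻¹ ∈ peiffer X n by
    simpa [mul_assoc] using Subgroup.mul_mem _ ha' hb'
  obtain ⟨ha1, ha2⟩ := Subgroup.mem_inf.1 ha
  cases n with
  | zero => simp [Subgroup.mem_bot.1 ha2, one_mem]
  | succ n =>
    have hd := σ_mem_degen X (Fin.last n) (lastFace X n g)
    have e : g * a * g⁻¹ = (comm ((X.σ (Fin.last n)).hom (lastFace X n g)) a * comm a g)⁻¹ *
        ((X.σ (Fin.last n)).hom (lastFace X n g) * a *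
          ((X.σ (Fin.last n)).hom (lastFace X n g))⁻¹) := by
      simp only [comm]; group
    rw [e]
    exact Subgroup.mul_mem _ (Subgroup.mem_sup_right (Subgroup.inv_mem _ (peiffer_comm X ha1)))
      (Subgroup.mem_sup_left (Subgroup.mem_inf.2
        ⟨(moore_normal X (n + 1)).conj_mem _ ha1 _,
          Subgroup.mul_mem _ (Subgroup.mul_mem _ hd ha2) (Subgroup.inv_mem _ hd)⟩))

instance peiffer_normal_ambient (n : ℕ) : (peiffer X n).Normal :=
  ⟨fun _ hy g => peiffer_conj_mem X n g hy⟩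

/-- The elements of `X_n` whose conjugation action on `C_n(X)` is trivial. -/
def actTrivial (n : ℕ) : Subgroup (X _⦋n⦌) :=
  (Subgroup.centralizer (((moore X n).map (QuotientGroup.mk' (peiffer X n)) :
    Subgroup (X _⦋n⦌ ⧸ peiffer X n)) : Set (X _⦋n⦌ ⧸ peiffer X n))).comap
      (QuotientGroup.mk' (peiffer X n))

instance actTrivial_normal (n : ℕ) : (actTrivial X n).Normal := by
  have : ((moore X n).map (QuotientGroup.mk' (peiffer X n))).Normal :=
    (moore_normal X n).map _ (QuotientGroup.mk'_surjective _)
  have := Subgroup.normal_centralizer (H := (moore X n).map (QuotientGroup.mk' (peiffer X n)))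
  exact this.comap _

theorem mem_actTrivial {n : ℕ} {g : X _⦋n⦌} :
    g ∈ actTrivial X n ↔
      ∀ z ∈ moore X n, (z : X _⦋n⦌ ⧸ peiffer X n) * g = (g : X _⦋n⦌ ⧸ peiffer X n) * z := by
  rw [actTrivial, Subgroup.mem_comap, Subgroup.mem_centralizer_iff]
  simp

theorem mk_comm_eq_one {n : ℕ} {a b : X _⦋n⦌} (h : comm a b ∈ peiffer X n) :
    (b : X _⦋n⦌ ⧸ peiffer X n) * a = (a : X _⦋n⦌ ⧸ peiffer X n) * b := by
  have h' := (QuotientGroup.eq_one_iff _).2 h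
  rw [comm, QuotientGroup.mk_mul, QuotientGroup.mk_mul, QuotientGroup.mk_mul, QuotientGroup.mk_inv,
    QuotientGroup.mk_inv] at h'
  rw [mul_inv_eq_one, mul_inv_eq_iff_eq_mul] at h'
  exact h'.symm

theorem mul_inv_σ_lastFace_mem_actTrivial {n : ℕ} (g : X _⦋n + 1⦌) :
    g * ((X.σ (Fin.last n)).hom (lastFace X n g))⁻¹ ∈ actTrivial X (n + 1) := by
  rw [← inv_mem_iff, mul_inv_rev, inv_inv, (actTrivial_normal X (n + 1)).mem_comm_iff]
  refine (mem_actTrivial X).2 fun z hz => ?_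
  refine mk_comm_eq_one X ?_
  have h : comm ((X.σ (Fin.last n)).hom (lastFace X n g)) z * comm z g ∈ peiffer X (n + 1) :=
    Subgroup.mem_sup_right (peiffer_comm X (x := g) hz)
  -- Conjugation by `g⁻¹` fuses the two commutators into the single commutator of `g⁻¹ * s_n d_{n+1}
  -- g` with `z`.
  have := (peiffer_normal_ambient X (n + 1)).conj_mem _ h g⁻¹
  convert this using 1
  simp only [comm]; group

/-- For `y` in the Moore complex there is a degenerate element with `j`-th face `y` and no other
nontrivial faces except for the last one, which is `y` or its inverse up to a degenerate factor. -/
theorem exists_degen_lift {n : ℕ} (j : ℕ) (hj : j ≤ n + 1) :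
    ∀ y ∈ moore X (n + 1), ∃ z ∈ degen X (n + 2),
      (X.δ ⟨j, by omega⟩).hom z = y ∧
      (∀ i (hi : i < n + 2), i ≠ j → (X.δ ⟨i, by omega⟩).hom z = 1) ∧
      ∃ b ∈ degen X (n + 1), lastFace X (n + 1) z = b * y ∨ lastFace X (n + 1) z = b * y⁻¹ := by
  -- The witness is the alternating product `s_j y * (s_{j+1} y)⁻¹ * s_{j+2} y * ⋯`, ending at
  -- `s_{n+1}`. Consecutive factors cancel on the face they share, so only faces `j` and the last
  -- survive.
  induction hj using Nat.decreasingInduction with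
  | self =>
    intro y hy
    refine ⟨(X.σ (Fin.last (n + 1))).hom y, σ_mem_degen X _ y, ?_, fun i hi hne => ?_, 1, one_mem _,
      Or.inl ?_⟩
    · exact δ_σ_self X (j := n + 1) (by omega) y
    · refine (δ_σ_of_le X (j := n) (by omega) (by omega) y).trans ?_
      rw [moore_δ_eq_one X hy (by omega), map_one]
    · rw [lastFace_σ_last, one_mul]
  | of_succ j hj ih =>
    intro y hy
    obtain ⟨z, hz, hz1, hz2, b, hb, hb'⟩ := ih y⁻¹ (inv_mem hy)
    have hlast : lastFace X (n + 1) ((X.σ ⟨j, by omega⟩).hom y) =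
        (X.σ ⟨j, by omega⟩).hom ((X.δ ⟨n + 1, by omega⟩).hom y) :=
      δ_σ_of_gt X (n := n) (i := n + 1) (j := j) (by omega) (by omega) y
    refine ⟨(X.σ ⟨j, by omega⟩).hom y * z, mul_mem (σ_mem_degen X _ y) hz, ?_, fun i hi hne => ?_,
      (X.σ ⟨j, by omega⟩).hom ((X.δ ⟨n + 1, by omega⟩).hom y) * b,
      mul_mem (σ_mem_degen X _ _) hb, ?_⟩
    · rw [map_mul, hz2 j (by omega) (by omega), mul_one]
      exact δ_σ_self X (by omega) y
    · rw [map_mul]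
      obtain hlt | hgt := lt_or_gt_of_ne hne
      · obtain ⟨j, rfl⟩ : ∃ k, j = k + 1 := ⟨j - 1, by omega⟩
        rw [hz2 i hi (by omega), mul_one]
        refine (δ_σ_of_le X (j := j) (by omega) (by omega) y).trans ?_
        rw [moore_δ_eq_one X hy (by omega), map_one]
      · obtain ⟨i, rfl⟩ : ∃ k, i = k + 1 := ⟨i - 1, by omega⟩
        obtain rfl | hne' := eq_or_ne i j
        · rw [hz1, δ_σ_succ X (by omega) y, mul_inv_cancel]
        · rw [hz2 (i + 1) hi (by omega), mul_one]
          refine (δ_σ_of_gt X (j := j) (by omega) (by omega) y).trans ?_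
          rw [moore_δ_eq_one X hy (by omega), map_one]
    · rw [map_mul, hlast, mul_assoc, mul_assoc]
      rcases hb' with h | h
      · exact Or.inr (by rw [h])
      · exact Or.inl (by rw [h, inv_inv])

/-- A degenerate element with a trivial face other than the last one acts trivially. -/
theorem mem_actTrivial_of_mem_degen {n : ℕ} {a : X _⦋n + 1⦌} (ha : a ∈ degen X (n + 1)) {j : ℕ}
    (hj : j < n + 1) (haj : (X.δ ⟨j, by omega⟩).hom a = 1) : a ∈ actTrivial X (n + 1) := by
  refine (mem_actTrivial X).2 fun y hy => ?_
  obtain ⟨z, hz, hz1, hz2, b, hb, hb'⟩ := exists_degen_lift X j hj.le y hy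
  -- Since `b⁻¹ * d_{n+2} z` is `y` or `y⁻¹`, it suffices that `a` commutes with `d_{n+2} z` and
  -- with `b` separately.
  have hz' : (y : X _⦋n + 1⦌ ⧸ peiffer X (n + 1)) * a =
        (a : X _⦋n + 1⦌ ⧸ peiffer X (n + 1)) * y ↔
      ((b⁻¹ * lastFace X (n + 1) z : X _⦋n + 1⦌) : X _⦋n + 1⦌ ⧸ peiffer X (n + 1)) * a =
        (a : X _⦋n + 1⦌ ⧸ peiffer X (n + 1)) *
          ((b⁻¹ * lastFace X (n + 1) z : X _⦋n + 1⦌) : X _⦋n + 1⦌ ⧸ peiffer X (n + 1)) := by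
    rcases hb' with h | h
    · rw [h, inv_mul_cancel_left]
    · rw [h, inv_mul_cancel_left, QuotientGroup.mk_inv]
      exact (Commute.inv_left_iff (a := (y : X _⦋n + 1⦌ ⧸ peiffer X (n + 1)))).symm
  have hq : b⁻¹ * lastFace X (n + 1) z ∈ moore X (n + 1) := by
    rcases hb' with h | h <;> rw [h, inv_mul_cancel_left]
    exacts [hy, inv_mem hy]
  rw [hz']
  -- The commutator of `s_{n+1} a` with `z` is a degenerate Moore element: its `j`-th face dies
  -- through `a`, the other faces through `z`. Its last face is the commutator of `a` with `d_{n+2}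
  -- z`.
  have h1 : Commute (lastFace X (n + 1) z : X _⦋n + 1⦌ ⧸ peiffer X (n + 1)) a := by
    refine mk_comm_eq_one X (Subgroup.mem_sup_right ?_)
    refine Subgroup.mem_map.2 ⟨comm ((X.σ (Fin.last (n + 1))).hom a) z,
      Subgroup.mem_inf.2 ⟨(mem_moore_succ' X).2 fun i hi => ?_,
        comm_mem _ (σ_mem_degen X _ a) hz⟩, ?_⟩
    · rw [map_comm']
      obtain rfl | hne := eq_or_ne i j
      · have : (X.δ ⟨i, by omega⟩).hom ((X.σ (Fin.last (n + 1))).hom a) = 1 := by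
          refine (δ_σ_of_le X (j := n) (by omega) (by omega) a).trans ?_
          rw [haj, map_one]
        rw [this]; simp [comm]
      · rw [hz2 i hi hne]; simp [comm]
    · rw [map_comm', lastFace_σ_last]
  -- For `i ≠ j` the `i`-th faces of `y^{±1}` and of `d_{n+2} z` are trivial, hence so is that of
  -- `b`. With `d_j a = 1` this puts the commutator of `a` and `b` in `NX ∩ D`.
  have h2 : Commute (b : X _⦋n + 1⦌ ⧸ peiffer X (n + 1)) a := by
    refine mk_comm_eq_one X (Subgroup.mem_sup_left (Subgroup.mem_inf.2
      ⟨(mem_moore_succ' X).2 fun i hi => ?_, comm_mem _ ha hb⟩))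
    rw [map_comm']
    obtain rfl | hne := eq_or_ne i j
    · rw [haj]; simp [comm]
    · have e1 : (X.δ ⟨i, by omega⟩).hom (lastFace X (n + 1) z) = 1 := by
        refine (δ_δ_of_le X (j := n + 1) (by omega) (by omega) z).trans ?_
        rw [hz2 i (by omega) hne, map_one]
      have e2 := moore_δ_eq_one X hq hi
      rw [map_mul, e1, mul_one, map_inv, inv_eq_one] at e2
      rw [e2]; simp [comm]
  exact (h2.inv_left.mul_left h1 : Commute _ _)

end Action

/-! ### Reduction of the action to the last vertex. -/

section Vertices

variable (X : SimplicialObject GrpCat.{u})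

theorem map_mem_degen {n : ℕ} {a : SimplexCategory} (θ : ⦋n + 1⦌ ⟶ a)
    (hθ : ¬ Function.Injective θ) (x : X.obj (op a)) : (X.map θ.op).hom x ∈ degen X (n + 1) := by
  obtain ⟨i, θ', rfl⟩ := SimplexCategory.eq_σ_comp_of_not_injective θ hθ
  rw [map_comp_apply]
  exact σ_mem_degen X i _

/-- The monotone map `i ↦ max i j`. -/
def maxMap (n : ℕ) (j : Fin (n + 1)) : ⦋n⦌ ⟶ ⦋n⦌ :=
  SimplexCategory.Hom.mk ⟨fun i => max i j, fun _ _ h => max_le_max h le_rfl⟩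

theorem maxMap_succ {n : ℕ} (j : Fin (n + 1)) :
    maxMap (n + 1) j.succ =
      maxMap (n + 1) j.castSucc ≫ SimplexCategory.σ j ≫ SimplexCategory.δ j.castSucc := by
  ext i : 3
  change max i j.succ = Fin.succAbove j.castSucc (Fin.predAbove j (max i j.castSucc))
  rcases le_or_gt i j.castSucc with h | h
  · rw [max_eq_right h, max_eq_right (h.trans j.castSucc_le_succ), Fin.predAbove_castSucc_self,
      Fin.succAbove_castSucc_self]
  · rw [max_eq_left h.le, max_eq_left (Fin.castSucc_lt_iff_succ_le.1 h)]
    obtain ⟨i, rfl⟩ := Fin.exists_succ_eq.2 (Fin.ne_zero_of_lt h)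
    rw [Fin.predAbove_succ_of_le _ _ (Fin.castSucc_lt_succ_iff.1 h),
      Fin.succAbove_of_le_castSucc _ _ (Fin.castSucc_le_castSucc_iff.2 (Fin.castSucc_lt_succ_iff.1 h))]

theorem maxMap_zero (n : ℕ) : maxMap n 0 = 𝟙 _ := by
  ext i : 3
  exact max_eq_left (Fin.zero_le i)

theorem maxMap_last (n : ℕ) :
    maxMap n (Fin.last n) = SimplexCategory.const ⦋n⦌ ⦋0⦌ 0 ≫
      SimplexCategory.const ⦋0⦌ ⦋n⦌ (Fin.last n) := by
  ext i : 3
  exact max_eq_right (Fin.le_last i)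

/-- The last vertex of an element of `X_n`. -/
def lastVertex (n : ℕ) : X _⦋n⦌ →* X _⦋0⦌ :=
  (X.map (SimplexCategory.const ⦋0⦌ ⦋n⦌ (Fin.last n)).op).hom

/-- The vertices are pushed to the last one, one at a time. The elements `x` and `s_j d_j x` are
degenerate with the same `j`-th face, and `j` is not the last index, so they act alike; composing
with the previous map gives the next one. -/
theorem mul_inv_maxMap_mem_actTrivial {n : ℕ} (j : Fin (n + 2)) :
    ∀ x ∈ degen X (n + 1), x * ((X.map (maxMap (n + 1) j).op).hom x)⁻¹ ∈ actTrivial X (n + 1) := by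
  induction j using Fin.induction with
  | zero => intro x _; simp [maxMap_zero, one_mem]
  | succ j ih =>
    intro x hx
    rw [maxMap_succ, map_comp_apply, map_comp_apply]
    have hy : (X.map (SimplexCategory.σ j).op).hom
      ((X.map (SimplexCategory.δ j.castSucc).op).hom x) ∈ degen X (n + 1) := σ_mem_degen X j _
    have h := ih _ hy
    have h0 : x * ((X.map (SimplexCategory.σ j).op).hom
        ((X.map (SimplexCategory.δ j.castSucc).op).hom x))⁻¹ ∈ actTrivial X (n + 1) := by
      refine mem_actTrivial_of_mem_degen X (mul_mem hx (inv_mem hy)) j.2 ?_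
      rw [map_mul, map_inv]
      refine mul_inv_eq_one.2 ?_
      exact (δ_σ_self X j.2 ((X.δ j.castSucc).hom x)).symm
    simpa [mul_assoc] using mul_mem h0 h

theorem mul_inv_totalDegen_mem_actTrivial {n : ℕ} {x : X _⦋n + 1⦌} (hx : x ∈ degen X (n + 1)) :
    x * (totalDegen X (n + 1) (lastVertex X (n + 1) x))⁻¹ ∈ actTrivial X (n + 1) := by
  have h := mul_inv_maxMap_mem_actTrivial X (Fin.last (n + 1)) x hx
  rwa [maxMap_last, map_comp_apply] at h

theorem exists_mul_inv_totalDegen_mem_actTrivial {n : ℕ} (g : X _⦋n + 1⦌) :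
    ∃ x, g * (totalDegen X (n + 1) x)⁻¹ ∈ actTrivial X (n + 1) := by
  refine ⟨lastVertex X (n + 1) ((X.σ (Fin.last n)).hom (lastFace X n g)), ?_⟩
  have h1 := mul_inv_σ_lastFace_mem_actTrivial X g
  have h2 := mul_inv_totalDegen_mem_actTrivial X (σ_mem_degen X (Fin.last n) (lastFace X n g))
  simpa [mul_assoc] using mul_mem h1 h2

/-- In dimensions at least two the Moore complex acts trivially. -/
theorem moore_le_actTrivial (n : ℕ) : moore X (n + 2) ≤ actTrivial X (n + 2) := by
  intro z hz
  have h1 := mul_inv_σ_lastFace_mem_actTrivial X z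
  have h2 : (X.σ (Fin.last (n + 1))).hom (lastFace X (n + 1) z) ∈ actTrivial X (n + 2) := by
    -- Dimension at least two enters here: `d_0` passes the last degeneracy, leaving `d_0 d_{n+2} z
    -- = d_{n+1} d_0 z = 1`.
    refine mem_actTrivial_of_mem_degen X (σ_mem_degen X _ _) (j := 0) (by omega) ?_
    refine (δ_σ_of_le X (j := n) (Nat.zero_le _) (by omega) _).trans ?_
    have : (X.δ ⟨0, by omega⟩).hom (lastFace X (n + 1) z) = 1 := by
      refine (δ_δ_of_le X (j := n + 1) (Nat.zero_le _) (by omega) z).trans ?_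
      rw [moore_δ_eq_one X hz (by omega), map_one]
    rw [this, map_one]
  simpa using mul_mem h1 h2

/-- In dimensions at least two boundaries of elements of `X_1` act trivially. -/
theorem totalDegen_mem_actTrivial (n : ℕ) {v : X _⦋1⦌} (hv : (X.δ 0).hom v = 1) :
    totalDegen X (n + 2) ((X.δ 1).hom v) ∈ actTrivial X (n + 2) := by
  -- Only the last vertex goes to `1`. With at least three vertices `θ` is not injective, so `θ^* v`
  -- is degenerate; its last vertex is `d_0 v = 1`, hence it acts trivially. Its last face is
  -- constant at `d_1 v`, hence it also acts as the total degeneracy of `d_1 v`.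
  let θ : ⦋n + 2⦌ ⟶ ⦋1⦌ := SimplexCategory.Hom.mk
    ⟨fun i => if i = Fin.last (n + 2) then 1 else 0, fun i j h => by
      dsimp only
      split_ifs with h1 h2
      · exact le_rfl
      · exact absurd (Fin.last_le_iff.1 (h1 ▸ h)) h2
      · exact Fin.zero_le _
      · exact le_rfl⟩
  have hθ0 : ∀ i : Fin (n + 3), i ≠ Fin.last (n + 2) → θ i = 0 := fun i hi => if_neg hi
  have hθ1 : θ (Fin.last (n + 2)) = 1 := if_pos rfl
  have hinj : ¬ Function.Injective θ := fun h => by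
    have := h ((hθ0 0 (by simp [Fin.ext_iff])).trans (hθ0 1 (by simp [Fin.ext_iff])).symm)
    simp at this
  have ha : (X.map θ.op).hom v ∈ actTrivial X (n + 2) := by
    have h := mul_inv_totalDegen_mem_actTrivial X (map_mem_degen X θ hinj v)
    have e : SimplexCategory.const ⦋0⦌ ⦋n + 2⦌ (Fin.last (n + 2)) ≫ θ = SimplexCategory.δ 0 := by
      ext i : 3
      rw [Subsingleton.elim (α := Fin 1) i 0]
      exact hθ1
    have e' : lastVertex X (n + 2) ((X.map θ.op).hom v) = 1 := by
      rw [lastVertex, ← map_comp_apply, e]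
      exact hv
    simpa only [e', map_one, inv_one, mul_one] using h
  have hb := mul_inv_σ_lastFace_mem_actTrivial X ((X.map θ.op).hom v)
  have e : SimplexCategory.σ (Fin.last (n + 1)) ≫ SimplexCategory.δ (Fin.last (n + 2)) ≫ θ =
      SimplexCategory.const ⦋n + 2⦌ ⦋0⦌ 0 ≫ SimplexCategory.δ 1 := by
    ext i : 3
    exact hθ0 _ (Fin.succAbove_ne _ _)
  have e' : (X.σ (Fin.last (n + 1))).hom (lastFace X (n + 1) ((X.map θ.op).hom v)) =
      totalDegen X (n + 2) ((X.δ 1).hom v) := by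
    have := congrArg (fun f => (X.map f.op).hom v) e
    simp only [map_comp_apply] at this
    exact this
  rw [e'] at hb
  simpa using mul_mem (inv_mem hb) ha

end Vertices

/-! ### Skeletal and connected augmented simplicial groups -/

section Skeletal

variable {G : Type u} [Group G]

/-- All elements of dimension larger than `m` are products of degenerate ones. -/
def IsSkeletal (X : SimplicialObject GrpCat.{u}) (m : ℕ) : Prop :=
  ∀ n, m ≤ n → degen X (n + 1) = ⊤

/-- Exactness of `X_1 → X_0 → G`. -/
def Augmented.IsExact (S : Augmented G) : Prop :=
  ∀ x ∈ S.aug.ker, ∃ v : S.obj _⦋1⦌, (S.obj.δ 0).hom v = 1 ∧ (S.obj.δ 1).hom v = x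

/-- The inclusion of `X_n` into the `n`-th group of `X(Ω)`. -/
noncomputable def kill.inl (X : SimplicialObject GrpCat.{u}) (m : ℕ) {Λ : Type u} (ϑ : Λ → X _⦋m⦌)
    (hϑ : ∀ l, ϑ l ∈ cycles X m) (a : SimplexCategory) :
    X.obj (op a) →* (kill X m ϑ hϑ).obj (op a) :=
  (Monoid.Coprod.inl : _ →* KillObj X m Λ a)

/-! ### Elements of a simplicial group with attached generators. -/

section Kill

variable {X : SimplicialObject GrpCat.{u}} {m : ℕ} {Λ : Type u} {ϑ : Λ → X _⦋m⦌}
  (hϑ : ∀ l, ϑ l ∈ cycles X m)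

theorem kill_map_inl {a b : SimplexCategory} (f : a ⟶ b) (x : X.obj (op b)) :
    ((kill X m ϑ hϑ).map f.op).hom (kill.inl X m ϑ hϑ b x) =
      kill.inl X m ϑ hϑ a ((X.map f.op).hom x) :=
  Monoid.Coprod.lift_apply_inl ..

theorem kill_map_gen {a : SimplexCategory} (t : a ⟶ ⦋m + 1⦌) (l : Λ) :
    ((kill X m ϑ hϑ).map t.op).hom (kill.gen X m ϑ hϑ l) = cellVal X m ϑ a t l := by
  change killMap X m ϑ t _ = _
  rw [kill.gen, killMap, Monoid.Coprod.lift_apply_inr, FreeGroup.lift_apply_of]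
  simp

/-- The group `X(Ω)_n` is generated by `X_n` and the elements `t^* y` with `t` surjective. -/
theorem kill_eq_top {a : SimplexCategory} {H : Subgroup ((kill X m ϑ hϑ).obj (op a))}
    (h1 : ∀ x, kill.inl X m ϑ hϑ a x ∈ H)
    (h2 : ∀ (t : a ⟶ ⦋m + 1⦌), Function.Surjective t → ∀ l,
      ((kill X m ϑ hϑ).map t.op).hom (kill.gen X m ϑ hϑ l) ∈ H) : H = ⊤ := by
  refine (Subgroup.eq_top_iff' H).2 fun w => ?_
  induction w using Monoid.Coprod.induction_on with
  | inl x => exact h1 x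
  | inr y =>
    induction y using FreeGroup.induction_on with
    | C1 => rw [map_one]; exact Subgroup.one_mem H
    | of c =>
      have h := h2 c.2.1 c.2.2 c.1
      rwa [kill_map_gen, cellVal, dif_pos c.2.2] at h
    | inv_of c hc => rw [map_inv]; exact Subgroup.inv_mem H hc
    | mul y z hy hz => rw [map_mul]; exact Subgroup.mul_mem H hy hz
  | mul x y hx hy => exact Subgroup.mul_mem H hx hy

/-- Above dimension `m + 1` a surjection onto `[m+1]` cannot be injective, so the new generators
there are degenerate. -/
theorem kill_isSkeletal (hX : IsSkeletal X m) : IsSkeletal (kill X m ϑ hϑ) (m + 1) := by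
  intro n hn
  refine kill_eq_top hϑ (fun x => ?_) fun t _ l => map_mem_degen _ t (fun hinj => ?_) _
  · have hx : x ∈ degen X (n + 1) := by rw [hX n (by omega)]; trivial
    have : degen X (n + 1) ≤ (degen (kill X m ϑ hϑ) (n + 1)).comap
        (kill.inl X m ϑ hϑ ⦋n + 1⦌) := by
      refine iSup_le fun i => ?_
      rintro _ ⟨z, rfl⟩
      rw [Subgroup.mem_comap, SimplicialObject.σ_def, ← kill_map_inl hϑ]
      exact σ_mem_degen (kill X m ϑ hϑ) i _
    exact this hx
  · have := Fintype.card_le_of_injective (α := Fin (n + 1 + 1)) (β := Fin (m + 1 + 1)) t hinj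
    simp at this
    omega

theorem kill_inl_surjective {n : ℕ} (hn : n ≤ m) :
    Function.Surjective (kill.inl X m ϑ hϑ ⦋n⦌) := by
  rw [← MonoidHom.range_eq_top]
  refine kill_eq_top hϑ (fun x => ⟨x, rfl⟩) fun t ht _ => ?_
  have := Fintype.card_le_of_surjective (α := Fin (n + 1)) (β := Fin (m + 1 + 1)) _ ht
  simp at this
  omega

end Kill

theorem AttachingData.mem_cycles_obj {S : Augmented G} {m : ℕ} (A : AttachingData S m) (l : A.Ω) :
    A.g l ∈ SimpGrp.cycles S.obj m :=
  S.mem_cycles (A.mem_cycles l)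

theorem stage_isSkeletal (P : GeneratingData G) : IsSkeletal P.stage.obj 0 := fun n _ =>
  (Subgroup.eq_top_iff' _).2 fun x => σ_mem_degen P.stage.obj (n := n) 0 x

theorem skeleton_isSkeletal {k : ℕ} (p : LevelPresentation G k) : IsSkeletal p.skeleton.obj k := by
  induction k with
  | zero => exact stage_isSkeletal (G := G) p
  | succ k ih => exact kill_isSkeletal p.data.mem_cycles_obj (ih p.restrict)

/-- The inclusion of an augmented simplicial group into the one with attached cells. -/
noncomputable def AttachingData.inl {S : Augmented G} {m : ℕ} (A : AttachingData S m)
    (a : SimplexCategory) : S.obj.obj (op a) →* A.attach.obj.obj (op a) :=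
  kill.inl S.obj m A.g A.mem_cycles_obj a

/-- The generators of an augmented simplicial group with attached cells. -/
noncomputable def AttachingData.gen {S : Augmented G} {m : ℕ} (A : AttachingData S m) (l : A.Ω) :
    A.attach.obj _⦋m + 1⦌ :=
  kill.gen S.obj m A.g A.mem_cycles_obj l

section Attach

variable {S : Augmented G} {m : ℕ} (A : AttachingData S m)

theorem AttachingData.map_inl {a b : SimplexCategory} (f : a ⟶ b) (x : S.obj.obj (op b)) :
    (A.attach.obj.map f.op).hom (A.inl b x) = A.inl a ((S.obj.map f.op).hom x) :=
  kill_map_inl A.mem_cycles_obj f x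

theorem AttachingData.aug_inl (x : S.obj _⦋0⦌) : A.attach.aug (A.inl ⦋0⦌ x) = S.aug x :=
  Monoid.Coprod.lift_apply_inl S.aug (1 : FreeGroup (Cell m A.Ω ⦋0⦌) →* G) x

theorem AttachingData.δ_castSucc_gen (l : A.Ω) (i : Fin (m + 1)) :
    (A.attach.obj.δ i.castSucc).hom (A.gen l) = 1 :=
  kill.δ_castSucc_gen S.obj m A.g A.mem_cycles_obj l i

theorem AttachingData.δ_last_gen (l : A.Ω) :
    (A.attach.obj.δ (Fin.last (m + 1))).hom (A.gen l) = A.inl ⦋m⦌ (A.g l) :=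
  kill.δ_last_gen S.obj m A.g A.mem_cycles_obj l

/-- Cells of dimension one create exactness: `d_1(ker d_0)` is normal because `d_1` is onto, and it
contains the attaching elements and the old boundaries, which together contain the kernel. In the
other case `X_0` gains nothing new, so exactness is inherited. -/
theorem AttachingData.attach_isExact (h : m = 0 ∨ S.IsExact) : A.attach.IsExact := by
  intro x' hx'
  obtain ⟨x, rfl⟩ := kill_inl_surjective A.mem_cycles_obj (Nat.zero_le m) x'
  change ∃ v : A.attach.obj _⦋1⦌, (A.attach.obj.δ 0).hom v = 1 ∧
    (A.attach.obj.δ 1).hom v = A.inl ⦋0⦌ x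
  have hx : x ∈ S.aug.ker := (A.aug_inl x).symm.trans hx'
  have hcase : ∀ v : S.obj _⦋1⦌, (S.obj.δ 0).hom v = 1 → ∃ w : A.attach.obj _⦋1⦌,
      (A.attach.obj.δ 0).hom w = 1 ∧
        (A.attach.obj.δ 1).hom w = A.inl ⦋0⦌ ((S.obj.δ 1).hom v) := fun v hv =>
    ⟨A.inl ⦋1⦌ v, (A.map_inl _ v).trans ((congrArg _ hv).trans (map_one _)), A.map_inl _ v⟩
  rcases h with rfl | h
  · let H : Subgroup (A.attach.obj _⦋0⦌) :=
      ((A.attach.obj.δ 0).hom.ker).map (A.attach.obj.δ 1).hom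
    have hsurj : Function.Surjective (A.attach.obj.δ 1).hom := fun y =>
      ⟨(A.attach.obj.σ 0).hom y, δ_σ_succ A.attach.obj (n := 0) (j := 0) (by omega) y⟩
    have hH : H.Normal := Subgroup.Normal.map inferInstance _ hsurj
    have hle : S.cycles 0 ≤ H.comap (A.inl ⦋0⦌) := by
      have : (H.comap (A.inl ⦋0⦌)).Normal := hH.comap _
      refine A.generates.trans (sup_le (Subgroup.normalClosure_le_normal ?_) ?_)
      · rintro _ ⟨l, rfl⟩
        exact ⟨A.gen l, A.δ_castSucc_gen l 0, A.δ_last_gen l⟩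
      · rintro _ ⟨v, hv, rfl⟩
        obtain ⟨w, hw1, hw2⟩ := hcase v ((mem_moore_succ S.obj).1 hv 0)
        exact ⟨w, hw1, hw2⟩
    obtain ⟨w, hw1, hw2⟩ := hle hx
    exact ⟨w, hw1, hw2⟩
  · obtain ⟨v, hv, rfl⟩ := h x hx
    exact hcase v hv

end Attach

theorem skeleton_isExact {k : ℕ} (p : LevelPresentation G (k + 1)) : p.skeleton.IsExact := by
  induction k with
  | zero => exact p.data.attach_isExact (Or.inl rfl)
  | succ k ih => exact p.data.attach_isExact (Or.inr (ih p.restrict))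

end Skeletal

/-! ### The augmentation in all dimensions -/

section Augmentation

variable {G : Type u} [Group G]

/-- Two vertices span an edge, and `aug_face` compares its ends. -/
theorem Augmented.aug_vertex_eq (S : Augmented G) {n : ℕ} (v w : ⦋0⦌ ⟶ ⦋n⦌) (x : S.obj _⦋n⦌) :
    S.aug ((S.obj.map v.op).hom x) = S.aug ((S.obj.map w.op).hom x) := by
  wlog h : v 0 ≤ w 0 generalizing v w
  · exact (this w v (le_of_not_ge h)).symm
  let e : ⦋1⦌ ⟶ ⦋n⦌ := SimplexCategory.mkOfLe (v 0) (w 0) h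
  have hv : v = SimplexCategory.δ 1 ≫ e := by
    ext i : 3
    rw [Subsingleton.elim (α := Fin 1) i 0]
    rfl
  have hw : w = SimplexCategory.δ 0 ≫ e := by
    ext i : 3
    rw [Subsingleton.elim (α := Fin 1) i 0]
    rfl
  rw [hv, hw, map_comp_apply, map_comp_apply]
  exact (S.aug_face _).symm

/-- The homomorphism `X_n → G` induced by the augmentation. -/
def Augmented.eps (S : Augmented G) (n : ℕ) : S.obj _⦋n⦌ →* G :=
  S.aug.comp (lastVertex S.obj n)

theorem Augmented.eps_map (S : Augmented G) {n m : ℕ} (f : ⦋n⦌ ⟶ ⦋m⦌) (x : S.obj _⦋m⦌) :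
    S.eps n ((S.obj.map f.op).hom x) = S.eps m x := by
  change S.aug ((S.obj.map _).hom _) = S.aug _
  rw [← map_comp_apply]
  exact S.aug_vertex_eq _ _ x

theorem Augmented.eps_δ (S : Augmented G) {n : ℕ} (i : Fin (n + 2)) (x : S.obj _⦋n + 1⦌) :
    S.eps n ((S.obj.δ i).hom x) = S.eps (n + 1) x :=
  S.eps_map (SimplexCategory.δ i) x

theorem Augmented.eps_zero (S : Augmented G) (x : S.obj _⦋0⦌) : S.eps 0 x = S.aug x := by
  have := S.aug_vertex_eq (SimplexCategory.const ⦋0⦌ ⦋0⦌ (Fin.last 0)) (𝟙 _) x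
  rw [op_id, S.obj.map_id] at this
  exact this

theorem Augmented.eps_totalDegen (S : Augmented G) (n : ℕ) (x : S.obj _⦋0⦌) :
    S.eps n (totalDegen S.obj n x) = S.aug x :=
  (S.eps_map _ x).trans (S.eps_zero x)

theorem Augmented.eps_eq_one_of_mem_moore (S : Augmented G) {n : ℕ} {x : S.obj _⦋n + 1⦌}
    (hx : x ∈ moore S.obj (n + 1)) : S.eps (n + 1) x = 1 := by
  have h := S.eps_δ (n := n) 0 x
  rw [show (S.obj.δ 0).hom x = 1 from (mem_moore_succ S.obj).1 hx 0, map_one] at h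
  exact h.symm

variable {S : Augmented G} {m : ℕ} (A : AttachingData S m)

theorem AttachingData.eps_inl (n : ℕ) (x : S.obj _⦋n⦌) :
    A.attach.eps n (A.inl ⦋n⦌ x) = S.eps n x :=
  (congrArg A.attach.aug (A.map_inl _ x)).trans (A.aug_inl _)

theorem AttachingData.gen_mem_moore (l : A.Ω) : A.gen l ∈ moore A.attach.obj (m + 1) :=
  (mem_moore_succ _).2 (A.δ_castSucc_gen l)

theorem AttachingData.inl_surjective {n : ℕ} (hn : n ≤ m) : Function.Surjective (A.inl ⦋n⦌) :=
  kill_inl_surjective A.mem_cycles_obj hn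

end Augmentation

/-! ### Fox derivatives -/

section Fox

variable {G : Type u} [Group G]

/-- The action of `G` on the multiplicative version of a `ℤ[G]`-module. -/
noncomputable def groupAct (M : Type*) [AddCommGroup M] [Module (MonoidAlgebra ℤ G) M] :
    G →* MulAut (Multiplicative M) :=
  (MulAutMultiplicative M).symm.toMonoidHom.comp
    ((DistribMulAction.toAddAut (MonoidAlgebra ℤ G)ˣ M).comp
      (MonoidHom.toHomUnits (MonoidAlgebra.of ℤ G)))

theorem toAdd_groupAct {M : Type*} [AddCommGroup M] [Module (MonoidAlgebra ℤ G) M] (g : G)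
    (x : Multiplicative M) :
    (groupAct M g x).toAdd = MonoidAlgebra.single g (1 : ℤ) • x.toAdd :=
  rfl

variable {S : Augmented G} {m : ℕ} (A : AttachingData S m)

/-- The homomorphism to `ℤ[G]^Ω ⋊ G` that is the augmentation on `X_{m+1}` and sends a new
generator to its basis vector. -/
noncomputable def AttachingData.foxHom :
    A.attach.obj _⦋m + 1⦌ →* Multiplicative (A.Ω →₀ MonoidAlgebra ℤ G) ⋊[groupAct _] G :=
  (Monoid.Coprod.lift (SemidirectProduct.inr.comp (S.eps (m + 1)))
    (FreeGroup.lift fun c => SemidirectProduct.inl (.ofAdd (Finsupp.single c.1 1))) :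
      KillObj S.obj m A.Ω ⦋m + 1⦌ →* _)

/-- The total Fox derivative on `X_{m+1}`, with values in `ℤ[G]^Ω`. -/
noncomputable def AttachingData.fox (w : A.attach.obj _⦋m + 1⦌) : A.Ω →₀ MonoidAlgebra ℤ G :=
  (A.foxHom w).left.toAdd

theorem AttachingData.foxHom_inl (x : S.obj _⦋m + 1⦌) :
    A.foxHom (A.inl ⦋m + 1⦌ x) = SemidirectProduct.inr (S.eps (m + 1) x) :=
  Monoid.Coprod.lift_apply_inl (M := S.obj _⦋m + 1⦌) (N := FreeGroup (Cell m A.Ω ⦋m + 1⦌)) _ _ x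

theorem AttachingData.foxHom_gen (l : A.Ω) :
    A.foxHom (A.gen l) = SemidirectProduct.inl (.ofAdd (Finsupp.single l 1)) :=
  (Monoid.Coprod.lift_apply_inr (M := S.obj _⦋m + 1⦌) (N := FreeGroup (Cell m A.Ω ⦋m + 1⦌))
    _ _ _).trans (FreeGroup.lift_apply_of ..)

theorem AttachingData.map_gen_of_surjective {t : ⦋m + 1⦌ ⟶ ⦋m + 1⦌} (ht : Function.Surjective t)
    (l : A.Ω) : (A.attach.obj.map t.op).hom (A.gen l) = A.gen l := by
  have : Epi t := SimplexCategory.epi_iff_surjective.2 ht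
  rw [SimplexCategory.eq_id_of_epi t]
  simp

theorem AttachingData.foxHom_right (w : A.attach.obj _⦋m + 1⦌) :
    (A.foxHom w).right = A.attach.eps (m + 1) w := by
  have h : (SemidirectProduct.rightHom.comp A.foxHom).eqLocus (A.attach.eps (m + 1)) = ⊤ := by
    refine kill_eq_top A.mem_cycles_obj (fun x => ?_) fun t ht l => ?_
    · change (A.foxHom (A.inl ⦋m + 1⦌ x)).right = A.attach.eps (m + 1) (A.inl ⦋m + 1⦌ x)
      rw [A.foxHom_inl, A.eps_inl, SemidirectProduct.right_inr]
    · change (A.foxHom ((A.attach.obj.map t.op).hom (A.gen l))).right =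
        A.attach.eps (m + 1) ((A.attach.obj.map t.op).hom (A.gen l))
      rw [A.map_gen_of_surjective ht, A.foxHom_gen, SemidirectProduct.right_inl,
        A.attach.eps_eq_one_of_mem_moore (A.gen_mem_moore l)]
  exact (h ▸ Subgroup.mem_top w : w ∈ (SemidirectProduct.rightHom.comp A.foxHom).eqLocus _)

/-- This is multiplication in the semidirect product; the twist is the augmentation by
`foxHom_right`. -/
theorem AttachingData.fox_mul (v w : A.attach.obj _⦋m + 1⦌) :
    A.fox (v * w) =
      A.fox v + MonoidAlgebra.single (A.attach.eps (m + 1) v) (1 : ℤ) • A.fox w := by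
  rw [fox, map_mul, SemidirectProduct.mul_left, toAdd_mul, toAdd_groupAct, A.foxHom_right]
  rfl

theorem AttachingData.fox_one : A.fox 1 = 0 := by
  rw [fox, map_one]; rfl

theorem AttachingData.fox_inl (x : S.obj _⦋m + 1⦌) : A.fox (A.inl ⦋m + 1⦌ x) = 0 := by
  rw [fox, A.foxHom_inl]; rfl

theorem AttachingData.fox_gen (l : A.Ω) : A.fox (A.gen l) = Finsupp.single l 1 := by
  rw [fox, A.foxHom_gen]; rfl

/-- Nothing new was attached in dimension `m`, so these degenerate elements come from the old group.
-/
theorem AttachingData.fox_σ (j : Fin (m + 1)) (w : A.attach.obj _⦋m⦌) :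
    A.fox ((A.attach.obj.σ j).hom w) = 0 := by
  obtain ⟨x, rfl⟩ := A.inl_surjective le_rfl w
  exact (congrArg A.fox (A.map_inl (SimplexCategory.σ j) x)).trans (A.fox_inl _)

/-- The alternating sum of the Fox derivatives of the faces. -/
noncomputable def AttachingData.foxSum (w : A.attach.obj _⦋m + 2⦌) : A.Ω →₀ MonoidAlgebra ℤ G :=
  ∑ i : Fin (m + 3), (-1 : ℤ) ^ (i : ℕ) • A.fox ((A.attach.obj.δ i).hom w)

/-- All faces of `v` have the same augmentation, so every summand is twisted by the same group
element. -/
theorem AttachingData.foxSum_mul (v w : A.attach.obj _⦋m + 2⦌) :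
    A.foxSum (v * w) =
      A.foxSum v + MonoidAlgebra.single (A.attach.eps (m + 2) v) (1 : ℤ) • A.foxSum w := by
  simp only [foxSum, map_mul, A.fox_mul, A.attach.eps_δ, smul_add, Finset.sum_add_distrib,
    Finset.smul_sum]
  congr 1
  exact Finset.sum_congr rfl fun i _ => smul_comm _ _ _

theorem AttachingData.foxSum_one : A.foxSum 1 = 0 := by
  simp [foxSum, A.fox_one]

/-- Faces `j` and `j + 1` both return the generator, with opposite signs; all other faces are
degenerate. -/
theorem AttachingData.foxSum_σ_gen (j : Fin (m + 2)) (l : A.Ω) :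
    A.foxSum ((A.attach.obj.σ j).hom (A.gen l)) = 0 := by
  rw [foxSum, Finset.sum_eq_add_of_mem j.castSucc j.succ (Finset.mem_univ _) (Finset.mem_univ _)
    j.castSucc_lt_succ.ne]
  · have h1 : (A.attach.obj.δ j.castSucc).hom ((A.attach.obj.σ j).hom (A.gen l)) = A.gen l :=
      δ_σ_self A.attach.obj j.2 _
    have h2 : (A.attach.obj.δ j.succ).hom ((A.attach.obj.σ j).hom (A.gen l)) = A.gen l :=
      δ_σ_succ A.attach.obj j.2 _
    rw [h1, h2, Fin.val_castSucc, Fin.val_succ, pow_succ, mul_neg_one, neg_smul, add_neg_cancel]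
  · rintro ⟨i, hi⟩ - ⟨h1, h2⟩
    obtain ⟨j, hj⟩ := j
    simp only [Fin.castSucc_mk, Fin.succ_mk, ne_eq, Fin.mk.injEq] at h1 h2
    obtain hlt | hgt := lt_or_gt_of_ne h1
    · obtain ⟨j, rfl⟩ : ∃ k, j = k + 1 := ⟨j - 1, by omega⟩
      have h := δ_σ_of_le A.attach.obj (i := i) (j := j) (n := m) (by omega) (by omega) (A.gen l)
      rw [h, A.fox_σ, smul_zero]
    · obtain ⟨i, rfl⟩ : ∃ k, i = k + 1 := ⟨i - 1, by omega⟩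
      have h := δ_σ_of_gt A.attach.obj (i := i) (j := j) (n := m) (by omega) (by omega) (A.gen l)
      rw [h, A.fox_σ, smul_zero]

/-- By the crossed product rule, generators suffice. Old elements have old faces, and the new
generators in dimension `m + 2` are the `s_j y`. -/
theorem AttachingData.foxSum_eq_zero (w : A.attach.obj _⦋m + 2⦌) : A.foxSum w = 0 := by
  let H : Subgroup (A.attach.obj _⦋m + 2⦌) :=
    { carrier := {w | A.foxSum w = 0}
      one_mem' := A.foxSum_one
      mul_mem' := fun {v w} hv hw => by
        change A.foxSum (v * w) = 0
        rw [A.foxSum_mul, show A.foxSum v = 0 from hv, show A.foxSum w = 0 from hw, smul_zero,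
          add_zero]
      inv_mem' := fun {w} hw => by
        have h := A.foxSum_mul w⁻¹ w
        rw [inv_mul_cancel, A.foxSum_one, show A.foxSum w = 0 from hw, smul_zero, add_zero] at h
        exact h.symm }
  have h : H = ⊤ := by
    refine kill_eq_top A.mem_cycles_obj (fun x => ?_) fun t ht l => ?_
    · refine Finset.sum_eq_zero fun i _ => ?_
      have h : A.fox ((A.attach.obj.δ i).hom (A.inl ⦋m + 2⦌ x)) = 0 :=
        (congrArg A.fox (A.map_inl (SimplexCategory.δ i) x)).trans (A.fox_inl _)
      exact (congrArg _ h).trans (smul_zero _)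
    · have : Epi t := SimplexCategory.epi_iff_surjective.2 ht
      obtain ⟨j, rfl⟩ := SimplexCategory.eq_σ_of_epi t
      exact A.foxSum_σ_gen j l
  exact (h ▸ Subgroup.mem_top w : w ∈ H)

theorem AttachingData.fox_lastFace {w : A.attach.obj _⦋m + 2⦌}
    (hw : w ∈ moore A.attach.obj (m + 2)) : A.fox (lastFace A.attach.obj (m + 1) w) = 0 := by
  have h := A.foxSum_eq_zero w
  rw [foxSum, Fin.sum_univ_castSucc, Finset.sum_eq_zero, zero_add] at h
  · have h' := congrArg (fun x => (-1 : ℤ) ^ ((Fin.last (m + 2) : Fin (m + 3)) : ℕ) • x) h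
    simp only [smul_smul, smul_zero, ← mul_pow, neg_one_mul, neg_neg, one_pow, one_smul] at h'
    exact h'
  · intro i _
    rw [(mem_moore_succ A.attach.obj).1 hw i, A.fox_one, smul_zero]

/-- The kernel of the Fox derivative. -/
noncomputable def AttachingData.foxKer : Subgroup (A.attach.obj _⦋m + 1⦌) where
  carrier := {w | A.fox w = 0}
  one_mem' := A.fox_one
  mul_mem' {v w} hv hw := by
    change A.fox (v * w) = 0
    rw [A.fox_mul, show A.fox v = 0 from hv, show A.fox w = 0 from hw, smul_zero, add_zero]
  inv_mem' {w} hw := by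
    have h := A.fox_mul w⁻¹ w
    rw [inv_mul_cancel, A.fox_one, show A.fox w = 0 from hw, smul_zero, add_zero] at h
    exact h.symm

theorem AttachingData.peiffer_le_foxKer : peiffer A.attach.obj (m + 1) ≤ A.foxKer := by
  refine sup_le (inf_le_right.trans (iSup_le fun i => ?_)) ?_
  · rintro _ ⟨x, rfl⟩
    exact A.fox_σ i x
  · rintro _ ⟨w, hw, rfl⟩
    exact A.fox_lastFace (Subgroup.mem_inf.1 hw).1

/-- The homomorphism `C_{m+1} → ℤ[G]^Ω` induced by the Fox derivative. -/
noncomputable def AttachingData.foxC :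
    C A.attach.obj (m + 1) →* Multiplicative (A.Ω →₀ MonoidAlgebra ℤ G) :=
  QuotientGroup.lift _
    { toFun := fun z : moore A.attach.obj (m + 1) => .ofAdd (A.fox z)
      map_one' := congrArg Multiplicative.ofAdd A.fox_one
      map_mul' := fun v w => by
        rw [Subgroup.coe_mul, A.fox_mul, A.attach.eps_eq_one_of_mem_moore v.2,
          ← MonoidAlgebra.one_def, one_smul, ofAdd_add] }
    fun _ hz => congrArg Multiplicative.ofAdd (A.peiffer_le_foxKer hz)

theorem AttachingData.fox_conj_totalDegen (x : A.attach.obj _⦋0⦌)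
    (z : A.attach.obj _⦋m + 1⦌) :
    A.fox (totalDegen A.attach.obj (m + 1) x * z * (totalDegen A.attach.obj (m + 1) x)⁻¹) =
      MonoidAlgebra.single (A.attach.aug x) (1 : ℤ) • A.fox z := by
  have h : totalDegen A.attach.obj (m + 1) x ∈ A.foxKer := by
    obtain ⟨y, rfl⟩ := A.inl_surjective (Nat.zero_le m) x
    exact (congrArg A.fox (A.map_inl _ y)).trans (A.fox_inl _)
  have h1 : A.fox _ = 0 := h
  have h2 : A.fox _ = 0 := inv_mem h
  rw [A.fox_mul, A.fox_mul, h1, h2, smul_zero, add_zero, zero_add, A.attach.eps_totalDegen]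

end Fox

/-! ### `C_n` of an augmented simplicial group with attached cells -/

section Free

theorem C.mk_eq_mk_iff {X : SimplicialObject GrpCat.{u}} {n : ℕ} {a b : moore X n} :
    C.mk X n a = C.mk X n b ↔
      ((a : X _⦋n⦌) : X _⦋n⦌ ⧸ peiffer X n) = ((b : X _⦋n⦌) : X _⦋n⦌ ⧸ peiffer X n) := by
  refine (QuotientGroup.eq (s := (peiffer X n).subgroupOf (moore X n))).trans ?_
  rw [QuotientGroup.eq, Subgroup.mem_subgroupOf]
  rfl

theorem C.mul_comm' (X : SimplicialObject GrpCat.{u}) (n : ℕ) (a b : C X (n + 2)) :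
    a * b = b * a := by
  obtain ⟨a, rfl⟩ := QuotientGroup.mk'_surjective _ a
  obtain ⟨b, rfl⟩ := QuotientGroup.mk'_surjective _ b
  change C.mk X (n + 2) a * C.mk X (n + 2) b = C.mk X (n + 2) b * C.mk X (n + 2) a
  rw [← map_mul, ← map_mul, C.mk_eq_mk_iff]
  exact (mem_actTrivial X).1 (moore_le_actTrivial X n b.2) a a.2

theorem mk_conj_eq_of_mem_actTrivial {X : SimplicialObject GrpCat.{u}} {n : ℕ} {g h z : X _⦋n⦌}
    (hgh : g * h⁻¹ ∈ actTrivial X n) (hz : z ∈ moore X n) :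
    ((g * z * g⁻¹ : X _⦋n⦌) : X _⦋n⦌ ⧸ peiffer X n) =
      ((h * z * h⁻¹ : X _⦋n⦌) : X _⦋n⦌ ⧸ peiffer X n) := by
  have h1 := (mem_actTrivial X).1 hgh _ ((moore_normal X n).conj_mem z hz h)
  rw [← QuotientGroup.mk_mul, ← QuotientGroup.mk_mul] at h1
  have e1 : g * z * g⁻¹ = g * h⁻¹ * (h * z * h⁻¹) * (g * h⁻¹)⁻¹ := by group
  rw [e1, QuotientGroup.mk_mul, ← h1, ← QuotientGroup.mk_mul, mul_inv_cancel_right]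

variable {G : Type u} [Group G] {S : Augmented G} {m : ℕ} (A : AttachingData S m)

/-- The new generators, as elements of the Moore complex. -/
noncomputable def AttachingData.mooreGen (l : A.Ω) : moore A.attach.obj (m + 1) :=
  ⟨A.gen l, A.gen_mem_moore l⟩

/-- The group `C_{m+1}` is generated by the translates of the classes of the new generators. -/
theorem AttachingData.closure_conjDegen_eq_top (hS : degen S.obj (m + 1) = ⊤) :
    Subgroup.closure (Set.range fun p : A.attach.obj _⦋0⦌ × A.Ω =>
      C.mk A.attach.obj (m + 1) (conjDegen A.attach.obj (m + 1) p.1 (A.mooreGen p.2))) = ⊤ := by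
  set K := Subgroup.closure (Set.range fun p : A.attach.obj _⦋0⦌ × A.Ω =>
      C.mk A.attach.obj (m + 1) (conjDegen A.attach.obj (m + 1) p.1 (A.mooreGen p.2)))
  let R : Subgroup (A.attach.obj _⦋m + 1⦌) := Subgroup.normalClosure (Set.range A.gen)
  have htop : (A.inl ⦋m + 1⦌).range ⊔ R = ⊤ := by
    refine kill_eq_top A.mem_cycles_obj (fun x => Subgroup.mem_sup_left ⟨x, rfl⟩) fun t ht l => ?_
    refine Subgroup.mem_sup_right ?_
    have h := A.map_gen_of_surjective ht l
    refine Eq.subst (motive := fun x => x ∈ R) h.symm ?_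
    exact Subgroup.subset_normalClosure ⟨l, rfl⟩
  have hdeg : ∀ x, A.inl ⦋m + 1⦌ x ∈ degen A.attach.obj (m + 1) := by
    have h : degen S.obj (m + 1) ≤ (degen A.attach.obj (m + 1)).comap (A.inl ⦋m + 1⦌) := by
      refine iSup_le fun i => ?_
      rintro _ ⟨z, rfl⟩
      have h := A.map_inl (SimplexCategory.σ i) z
      refine Eq.subst (motive := fun x => x ∈ degen A.attach.obj (m + 1)) h ?_
      exact σ_mem_degen A.attach.obj i _
    exact fun x => h (hS ▸ Subgroup.mem_top x)
  -- An arbitrary conjugate of a generator has the same class as a conjugate by some total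
  -- degeneracy.
  have hR : R ≤ (K.comap (C.mk A.attach.obj (m + 1))).map (moore A.attach.obj (m + 1)).subtype := by
    refine (Subgroup.closure_le _).2 fun w hw => ?_
    obtain ⟨_, ⟨l, rfl⟩, hw⟩ := Group.mem_conjugatesOfSet_iff.1 hw
    obtain ⟨g, rfl⟩ := isConj_iff.1 hw
    refine ⟨⟨g * A.gen l * g⁻¹, (moore_normal _ _).conj_mem _ (A.gen_mem_moore l) g⟩, ?_, rfl⟩
    obtain ⟨x, hx⟩ := exists_mul_inv_totalDegen_mem_actTrivial A.attach.obj g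
    refine Subgroup.subset_closure ⟨(x, l), ?_⟩
    exact C.mk_eq_mk_iff.2 (mk_conj_eq_of_mem_actTrivial hx (A.gen_mem_moore l)).symm
  refine (Subgroup.eq_top_iff' _).2 fun c => ?_
  obtain ⟨w, rfl⟩ := QuotientGroup.mk'_surjective _ c
  obtain ⟨_, ⟨x, rfl⟩, r, hr, hxr⟩ :=
    Subgroup.mem_sup_of_normal_right.1 (htop ▸ Subgroup.mem_top (w : A.attach.obj _⦋m + 1⦌))
  obtain ⟨r, hr', rfl⟩ := hR hr
  -- The old factor is a quotient of two Moore elements and is degenerate, so it vanishes in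
  -- `C_{m+1}`.
  have hx : A.inl ⦋m + 1⦌ x ∈ moore A.attach.obj (m + 1) := by
    rw [eq_mul_inv_of_mul_eq hxr]
    exact mul_mem w.2 (inv_mem r.2)
  have hP : A.inl ⦋m + 1⦌ x ∈ peiffer A.attach.obj (m + 1) :=
    Subgroup.mem_sup_left (Subgroup.mem_inf.2 ⟨hx, hdeg x⟩)
  have : C.mk A.attach.obj (m + 1) w = C.mk A.attach.obj (m + 1) r := by
    rw [C.mk_eq_mk_iff, ← hxr, QuotientGroup.mk_mul, (QuotientGroup.eq_one_iff _).2 hP, one_mul]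
    rfl
  exact Eq.subst (motive := fun x => x ∈ K) this.symm hr'

theorem AttachingData.foxC_conjDegen (x : A.attach.obj _⦋0⦌) (z : moore A.attach.obj (m + 1)) :
    (A.foxC (C.mk _ _ (conjDegen A.attach.obj (m + 1) x z))).toAdd =
      MonoidAlgebra.single (A.attach.aug x) (1 : ℤ) • (A.foxC (C.mk _ _ z)).toAdd :=
  A.fox_conj_totalDegen x z

theorem AttachingData.foxC_mooreGen (l : A.Ω) :
    (A.foxC (C.mk _ _ (A.mooreGen l))).toAdd = Finsupp.single l 1 :=
  A.fox_gen l

/-- In dimensions at least two, the conjugation action on `C_n` factors through the augmentation of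
an exact augmented simplicial group. -/
theorem Augmented.mk_conjDegen_eq {T : Augmented G} (hT : T.IsExact) {n : ℕ} {x y : T.obj _⦋0⦌}
    (hxy : T.aug x = T.aug y) (z : moore T.obj (n + 2)) :
    C.mk T.obj (n + 2) (conjDegen T.obj (n + 2) x z) =
      C.mk T.obj (n + 2) (conjDegen T.obj (n + 2) y z) := by
  refine C.mk_eq_mk_iff.2 (mk_conj_eq_of_mem_actTrivial ?_ z.2)
  obtain ⟨v, hv, hv'⟩ := hT (x * y⁻¹) (by simp [MonoidHom.mem_ker, hxy])
  rw [← map_inv, ← map_mul, ← hv']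
  exact totalDegen_mem_actTrivial T.obj n hv

theorem AttachingData.bijective_foxC {m : ℕ} (A : AttachingData S (m + 1))
    (hS : degen S.obj (m + 2) = ⊤) (hA : A.attach.IsExact) : Function.Bijective A.foxC := by
  let : CommGroup (C A.attach.obj (m + 2)) := commGroupOf (C.mul_comm' A.attach.obj m)
  choose s hs using A.attach.aug_surjective
  -- The candidate inverse uses a chosen lift `s g` of each group element. It is only additive; both
  -- composites are compared with the identity on generators, and exactness makes the choice of lift
  -- immaterial.
  let ψ : (A.Ω →₀ MonoidAlgebra ℤ G) →+ Additive (C A.attach.obj (m + 2)) :=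
    Finsupp.liftAddHom fun l => (Finsupp.liftAddHom fun g =>
      zmultiplesHom _ (Additive.ofMul (C.mk A.attach.obj (m + 2)
        (conjDegen A.attach.obj (m + 2) (s g) (A.mooreGen l))))).comp
          MonoidAlgebra.coeffAddEquiv.toAddMonoidHom
  have hψ : ∀ l g n, ψ (Finsupp.single l (MonoidAlgebra.single g n)) =
      n • Additive.ofMul (C.mk A.attach.obj (m + 2)
        (conjDegen A.attach.obj (m + 2) (s g) (A.mooreGen l))) := fun l g n => by
    have h : MonoidAlgebra.coeffAddEquiv (MonoidAlgebra.single g n) = Finsupp.single g n := rfl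
    simp [ψ, h]
  have hfox : ∀ x l, (A.foxC (C.mk _ _ (conjDegen A.attach.obj (m + 2) x (A.mooreGen l)))).toAdd =
      Finsupp.single l (MonoidAlgebra.single (A.attach.aug x) (1 : ℤ)) := fun x l => by
    rw [A.foxC_conjDegen, A.foxC_mooreGen, Finsupp.smul_single, smul_eq_mul, mul_one]
  let φ : Additive (C A.attach.obj (m + 2)) →+ (A.Ω →₀ MonoidAlgebra ℤ G) :=
    MonoidHom.toAdditiveLeft A.foxC
  have h1 : ψ.toMultiplicativeLeft.comp A.foxC = MonoidHom.id _ := by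
    refine MonoidHom.eq_of_eqOn_dense (A.closure_conjDegen_eq_top hS) ?_
    rintro _ ⟨⟨x, l⟩, rfl⟩
    change (ψ (A.foxC (C.mk _ _ _)).toAdd).toMul = C.mk _ _ _
    rw [hfox, hψ, one_smul, toMul_ofMul]
    exact A.attach.mk_conjDegen_eq hA (hs _) _
  have h2 : φ.comp ψ = AddMonoidHom.id _ := by
    refine Finsupp.addHom_ext' fun l => MonoidAlgebra.addMonoidHom_ext fun g n => ?_
    change φ (ψ (Finsupp.single l (MonoidAlgebra.single g n))) =
      Finsupp.single l (MonoidAlgebra.single g n)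
    rw [hψ, map_zsmul]
    refine (congrArg (n • ·) (hfox (s g) l)).trans ?_
    rw [hs, Finsupp.smul_single, MonoidAlgebra.smul_single, smul_eq_mul, mul_one]
  exact ⟨Function.LeftInverse.injective (g := ψ.toMultiplicativeLeft) (DFunLike.congr_fun h1),
    Function.RightInverse.surjective (f := φ) (g := ψ) (DFunLike.congr_fun h2)⟩

end Free

end SimpGrp

/-! ### The free module structure on `C_k`. -/

theorem mainTheorem2 {G : Type u} [Group G] (F : SimpGrp.ConstructionData G) (k : ℕ) (hk : 2 ≤ k) :
    ∃ hcomm : ∀ a b : SimpGrp.C (F.skeleton k).obj k, a * b = b * a,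
      letI : CommGroup (SimpGrp.C (F.skeleton k).obj k) := SimpGrp.commGroupOf hcomm
      ∃ _ : Module (MonoidAlgebra ℤ G) (Additive (SimpGrp.C (F.skeleton k).obj k)),
        (∀ (x : (F.skeleton k).obj.obj (Opposite.op (SimplexCategory.mk 0)))
            (z : SimpGrp.moore (F.skeleton k).obj k),
          MonoidAlgebra.single ((F.skeleton k).aug x) (1 : ℤ) •
              Additive.ofMul (SimpGrp.C.mk (F.skeleton k).obj k z) =
            Additive.ofMul (SimpGrp.C.mk (F.skeleton k).obj k
              (SimpGrp.conjDegen (F.skeleton k).obj k x z))) ∧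
        ∃ b : Module.Basis (F.Y k) (MonoidAlgebra ℤ G)
            (Additive (SimpGrp.C (F.skeleton k).obj k)),
          ∀ y : F.Y k, b y = Additive.ofMul (SimpGrp.C.mk (F.skeleton k).obj k (F.gen k y)) := by
  obtain ⟨m, rfl⟩ : ∃ m, k = m + 2 := ⟨k - 2, by omega⟩
  refine ⟨SimpGrp.C.mul_comm' _ m, ?_⟩
  let : CommGroup (SimpGrp.C (F.skeleton (m + 2)).obj (m + 2)) :=
    SimpGrp.commGroupOf (SimpGrp.C.mul_comm' _ m)
  let A : SimpGrp.AttachingData _ (m + 1) := (F.level (m + 2)).data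
  have hbij : Function.Bijective A.foxC := A.bijective_foxC
    (SimpGrp.skeleton_isSkeletal (F.level (m + 2)).restrict (m + 1) le_rfl)
    (SimpGrp.skeleton_isExact (F.level (m + 2)))
  let e : Additive (SimpGrp.C (F.skeleton (m + 2)).obj (m + 2)) ≃+
      (F.Y (m + 2) →₀ MonoidAlgebra ℤ G) :=
    AddEquiv.ofBijective (MonoidHom.toAdditiveLeft A.foxC) hbij
  -- The scalar action is pulled back along `e`; `foxC_conjDegen` identifies it with conjugation.
  let : Module (MonoidAlgebra ℤ G) (Additive (SimpGrp.C (F.skeleton (m + 2)).obj (m + 2))) :=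
    AddEquiv.module (MonoidAlgebra ℤ G) e
  have hsmul : ∀ (r : MonoidAlgebra ℤ G) c, e (r • c) = r • e c := fun r c =>
    e.apply_symm_apply _
  refine ⟨this, fun x z => e.injective ?_,
    .ofRepr { e with map_smul' := hsmul }, fun y => e.injective ?_⟩
  · rw [hsmul]
    exact (A.foxC_conjDegen x z).symm
  · exact (e.apply_symm_apply _).trans (A.foxC_mooreGen y).symm
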